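/- **Lie algebra.** Let $Q=\bigoplus_{i=1}^6\mathbb Z\alpha_i$ be the root lattice of type $E_6$, with Dynkin diagram edges $1\!-\!3,\,3\!-\!4,\,4\!-\!2,\,4\!-\!5,\,5\!-\!6$, form $(\cdot,\cdot)$ and roots $\Phi=\{\alpha\in Q\mid(\alpha,\alpha)=2\}$. Put $F(\sum k_i\alpha_i,\sum l_j\alpha_j)=(-1)^{\sum_i k_il_i+k_1l_3+k_4l_2+k_3l_4+k_5l_4+k_6l_5}$ and let $\mathcal G=\bigoplus_{i=1}^6\mathbb C\alpha_i\oplus\bigoplus_{\alpha\in\Phi}\mathbb CE_\alpha$ be the simple Lie algebra of type $E_6$ with brackets (for $h,h'\in\bigoplus_i\mathbb C\alpha_i$) $[h,h']=0$, $[h,E_\alpha]=(h,\alpha)E_\alpha$, $[E_\alpha,E_{-\alpha}]=-\alpha$, and, for $\alpha+\beta\ne0$, $[E_\alpha,E_\beta]=F(\alpha,\beta)E_{\alpha+\beta}$ if $\alpha+\beta\in\Phi$ and $0$ otherwise. Let $\mathcal G^{D_5}\cong o(10,\mathbb C)$ be the subalgebra spanned by $\alpha_1,\dots,\alpha_5$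 and the $E_\beta$ with $\beta\in\Phi\cap\bigoplus_{i\le5}\mathbb Z\alpha_i$, and $\mathcal G_0=\mathcal G^{D_5}\oplus\mathbb C\widehat\alpha$ with $\widehat\alpha=2\alpha_1+3\alpha_2+4\alpha_3+6\alpha_4+5\alpha_5+4\alpha_6$. Let $\beta_1,\dots,\beta_{16}$ be the positive roots involving $\alpha_6$, with coefficient vectors (in $\alpha_1,\dots,\alpha_6$), in this order, $000001$, $000011$, $000111$, $001111$, $010111$, $011111$, $101111$, $111111$, $011211$, $111211$, $011221$, $112211$, $111221$, $112221$, $112321$, $122321$, and put $\xi_i=E_{\beta_i}$, $\eta_i=E_{-\beta_i}$. Then $\mathcal G=\bigoplus_i\mathbb C\eta_i\oplus\mathcal G_0\oplus\bigoplus_i\mathbb C\xi_i$. **Module.** Let $\mathcal A=\mathbb C[x_1,\dots,x_{16}]$. For $u\in\mathcal G_0$ with $[u,\eta_i]=\sum_j\varphi_{i,j}(u)\eta_j$ put $u|_{\mathcal A}=\sum_{i,j}\varphi_{i,j}(u)x_j\partial_{x_i}$. Let $P_i$ $(1\le i\le 16)$ be the vector field on $\mathcal A$ with homogeneous quadratic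 coefficients determined by $[\partial_{x_r},P_i]=[\xi_r,\eta_i]|_{\mathcal A}$ for all $r$; explicitly, $P_1=x_1D-\zeta_1\partial_{x_{11}}-\zeta_2\partial_{x_{13}}-\zeta_3\partial_{x_{14}}-\zeta_4\partial_{x_{15}}-\zeta_{10}\partial_{x_{16}}$ with $D=\sum_ix_i\partial_{x_i}$, $\zeta_1=x_1x_{11}+x_2x_9-x_3x_6+x_4x_5$, $\zeta_2=x_1x_{13}+x_2x_{10}-x_3x_8+x_5x_7$, $\zeta_3=x_1x_{14}+x_2x_{12}-x_4x_8+x_6x_7$, $\zeta_4=x_1x_{15}-x_3x_{12}+x_4x_{10}-x_7x_9$, $\zeta_{10}=x_1x_{16}+x_5x_{12}-x_6x_{10}+x_8x_9$, and similarly for the other $P_i$. Fix $c\in\mathbb C$. For a $\mathcal G^{D_5}$-module $M$ let $\varrho$ be the action of $\mathcal G_0$ on $M$ that extends the action of $\mathcal G^{D_5}$ by $\varrho(\widehat\alpha)=2c\cdot\mathrm{Id}$, and let $\mathcal G$ act on $\widehat M=\mathcal A\otimes_{\mathbb C}M$ by $$u\mapsto u|_{\mathcal A}\otimes1+1\otimes\varrho(u)\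 (u\in\mathcal G_0),\qquad \xi_i\mapsto\partial_{x_i}\otimes1,\qquad \eta_i\mapsto P_i\otimes1+\sum_{r=1}^{16}x_r\otimes\varrho([\xi_r,\eta_i]).$$ **Corollary 6.5.** Let $V(0)$ be the one-dimensional trivial module of $\mathcal G^{D_5}\cong o(10,\mathbb C)$, so that $\widehat{V(0)}\cong\mathbb C[x_1,\dots,x_{16}]$ as a vector space. If $c\in\mathbb C$ and $c\ne n-6$ for every integer $n\ge0$, then the formulas above make $\widehat{V(0)}$ a $\mathcal G$-module, and this $\mathcal G$-module is irreducible. -/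

import Mathlib

open scoped TensorProduct

noncomputable section

namespace E6

/-! ### The root lattice of type `E₆`

The entry with index `i : Fin 6` is the coefficient of the simple root `α_{i+1}`; the nodes of the
Dynkin diagram are numbered so that its edges are `1-3`, `3-4`, `4-2`, `4-5`, `5-6`. -/

/-- The root lattice `Q = ℤα₁ ⊕ ⋯ ⊕ ℤα₆`. -/
abbrev Lattice : Type := Fin 6 → ℤ

/-- The symmetric bilinear form given by the Cartan matrix of type `E₆`, over any ring of scalars
(it is used on the lattice and on its complexification). -/
def form {R : Type*} [CommRing R] (a b : Fin 6 → R) : R :=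
  2 * (a 0 * b 0 + a 1 * b 1 + a 2 * b 2 + a 3 * b 3 + a 4 * b 4 + a 5 * b 5)
    - (a 0 * b 2 + a 2 * b 0) - (a 2 * b 3 + a 3 * b 2) - (a 3 * b 1 + a 1 * b 3)
    - (a 3 * b 4 + a 4 * b 3) - (a 4 * b 5 + a 5 * b 4)

/-- The root system `Φ = {α ∈ Q | (α, α) = 2}`. -/
abbrev Root : Type := {a : Lattice // form a a = 2}

/-- The exponent in the definition of the sign `F`. -/
def signExp (k l : Lattice) : ℤ :=
  (k 0 * l 0 + k 1 * l 1 + k 2 * l 2 + k 3 * l 3 + k 4 * l 4 + k 5 * l 5)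
    + k 0 * l 2 + k 3 * l 1 + k 2 * l 3 + k 4 * l 3 + k 5 * l 4

/-- The bimultiplicative sign `F : Q × Q → {1, -1}`. -/
def sgnF (k l : Lattice) : ℂ := (((signExp k l).negOnePow : ℤˣ) : ℤ)

/-- The underlying space `H ⊕ ⨁_{α ∈ Φ} ℂ E_α` of the Lie algebra of type `E₆`, where
`H = ⨁ ℂ αᵢ`. -/
def G : Type := (Fin 6 → ℂ) × (Root →₀ ℂ)

instance : AddCommGroup G := inferInstanceAs (AddCommGroup ((Fin 6 → ℂ) × (Root →₀ ℂ)))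
instance : Module ℂ G := inferInstanceAs (Module ℂ ((Fin 6 → ℂ) × (Root →₀ ℂ)))

/-- The inclusion of the Cartan subalgebra `H`. -/
def ofH : (Fin 6 → ℂ) →ₗ[ℂ] G := LinearMap.inl ℂ (Fin 6 → ℂ) (Root →₀ ℂ)

/-- The inclusion of the sum of the root spaces. -/
def ofR : (Root →₀ ℂ) →ₗ[ℂ] G := LinearMap.inr ℂ (Fin 6 → ℂ) (Root →₀ ℂ)

/-- The component in `H`. -/
def hPart : G →ₗ[ℂ] (Fin 6 → ℂ) := LinearMap.fst ℂ (Fin 6 → ℂ) (Root →₀ ℂ)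

/-- The component in the sum of the root spaces; `rPart x α` is the coefficient of `E_α` in `x`. -/
def rPart : G →ₗ[ℂ] (Root →₀ ℂ) := LinearMap.snd ℂ (Fin 6 → ℂ) (Root →₀ ℂ)

/-- A lattice vector as an element of `ℂ ⊗ Q`. -/
def toC (v : Lattice) : Fin 6 → ℂ := fun i => (v i : ℂ)

/-- `E_v` when the lattice vector `v` is a root, and `0` otherwise. -/
def E (v : Lattice) : G :=
  if h : form v v = 2 then ofR (Finsupp.single (⟨v, h⟩ : Root) 1) else 0

/-- The bracket of two root vectors: `[E_α, E_{-α}] = -α`, and for `α + β ≠ 0`,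
`[E_α, E_β] = F(α, β) E_{α+β}` if `α + β` is a root and `0` otherwise. -/
def rootBracket (a b : Lattice) : G :=
  if a + b = 0 then -ofH (toC a) else sgnF a b • E (a + b)

/-- The bilinear extension of `rootBracket`. -/
def bracketRR : (Root →₀ ℂ) →ₗ[ℂ] (Root →₀ ℂ) →ₗ[ℂ] G :=
  Finsupp.linearCombination ℂ fun a : Root =>
    Finsupp.linearCombination ℂ fun b : Root => rootBracket a.1 b.1

/-- The action `[h, ∑ b_β E_β] = ∑ b_β (h, β) E_β` of `H` on the sum of the root spaces. -/
def bracketHR (h : Fin 6 → ℂ) : (Root →₀ ℂ) →ₗ[ℂ] G :=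
  Finsupp.linearCombination ℂ fun b : Root => form h (toC b.1) • E b.1

/-- The Lie bracket: `[H, H] = 0`, `[h, E_α] = -[E_α, h] = (h, α) E_α`, and `rootBracket` on root
vectors. -/
instance : Bracket G G where
  bracket x y := bracketHR (hPart x) (rPart y) - bracketHR (hPart y) (rPart x)
    + bracketRR (rPart x) (rPart y)

theorem bracket_def (x y : G) : ⁅x, y⁆ = bracketHR (hPart x) (rPart y)
    - bracketHR (hPart y) (rPart x) + bracketRR (rPart x) (rPart y) := rfl

/-! ### Verification of the axioms of a Lie algebra -/

theorem form_comm {R : Type*} [CommRing R] (a b : Fin 6 → R) : form a b = form b a := by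
  simp only [form]; ring

theorem form_add_left {R : Type*} [CommRing R] (a b c : Fin 6 → R) :
    form (a + b) c = form a c + form b c := by
  simp only [form, Pi.add_apply]; ring

theorem form_add_right {R : Type*} [CommRing R] (a b c : Fin 6 → R) :
    form a (b + c) = form a b + form a c := by
  simp only [form, Pi.add_apply]; ring

theorem form_neg_left {R : Type*} [CommRing R] (a b : Fin 6 → R) :
    form (-a) b = -form a b := by
  simp only [form, Pi.neg_apply]; ring

theorem form_neg_right {R : Type*} [CommRing R] (a b : Fin 6 → R) :
    form a (-b) = -form a b := by
  simp only [form, Pi.neg_apply]; ring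

theorem form_smul_left {R : Type*} [CommRing R] (r : R) (a b : Fin 6 → R) :
    form (r • a) b = r * form a b := by
  simp only [form, Pi.smul_apply, smul_eq_mul]; ring

theorem form_zero_left {R : Type*} [CommRing R] (a : Fin 6 → R) : form 0 a = 0 := by
  simp [form]

theorem form_toC (a b : Lattice) : form (toC a) (toC b) = ((form a b : ℤ) : ℂ) := by
  simp only [form, toC]; push_cast; ring

theorem toC_add (a b : Lattice) : toC (a + b) = toC a + toC b := by
  ext i; simp [toC]

theorem toC_neg (a : Lattice) : toC (-a) = -toC a := by
  ext i; simp [toC]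

theorem six_form (v : Lattice) : 6 * form v v = 3 * (2 * v 0 - v 2) ^ 2 + 3 * (2 * v 1 - v 3) ^ 2
    + 3 * (2 * v 5 - v 4) ^ 2 + (3 * v 2 - 2 * v 3) ^ 2 + (3 * v 4 - 2 * v 3) ^ 2 + v 3 ^ 2 := by
  simp only [form]; ring

theorem form_nonneg (v : Lattice) : 0 ≤ form v v := by
  have := six_form v
  nlinarith [sq_nonneg (2 * v 0 - v 2), sq_nonneg (2 * v 1 - v 3), sq_nonneg (2 * v 5 - v 4),
    sq_nonneg (3 * v 2 - 2 * v 3), sq_nonneg (3 * v 4 - 2 * v 3), sq_nonneg (v 3)]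

theorem eq_zero_of_form (v : Lattice) (h : form v v = 0) : v = 0 := by
  have h6 := six_form v
  rw [h] at h6
  have a1 := sq_nonneg (2 * v 0 - v 2)
  have a2 := sq_nonneg (2 * v 1 - v 3)
  have a3 := sq_nonneg (2 * v 5 - v 4)
  have a4 := sq_nonneg (3 * v 2 - 2 * v 3)
  have a5 := sq_nonneg (3 * v 4 - 2 * v 3)
  have a6 := sq_nonneg (v 3)
  have b1 : 2 * v 0 - v 2 = 0 := pow_eq_zero_iff two_ne_zero |>.mp (by linarith)
  have b2 : 2 * v 1 - v 3 = 0 := pow_eq_zero_iff two_ne_zero |>.mp (by linarith)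
  have b3 : 2 * v 5 - v 4 = 0 := pow_eq_zero_iff two_ne_zero |>.mp (by linarith)
  have b4 : 3 * v 2 - 2 * v 3 = 0 := pow_eq_zero_iff two_ne_zero |>.mp (by linarith)
  have b5 : 3 * v 4 - 2 * v 3 = 0 := pow_eq_zero_iff two_ne_zero |>.mp (by linarith)
  have b6 : v 3 = 0 := pow_eq_zero_iff two_ne_zero |>.mp (by linarith)
  ext i
  fin_cases i <;> simp <;> omega

theorem sgnF_add_left (a b c : Lattice) : sgnF (a + b) c = sgnF a c * sgnF b c := by
  have : signExp (a + b) c = signExp a c + signExp b c := by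
    simp only [signExp, Pi.add_apply]; ring
  simp only [sgnF, this, Int.negOnePow_add]; push_cast; ring

theorem sgnF_add_right (a b c : Lattice) : sgnF a (b + c) = sgnF a b * sgnF a c := by
  have : signExp a (b + c) = signExp a b + signExp a c := by
    simp only [signExp, Pi.add_apply]; ring
  simp only [sgnF, this, Int.negOnePow_add]; push_cast; ring

theorem sgnF_neg_left (a b : Lattice) : sgnF (-a) b = sgnF a b := by
  have : signExp (-a) b = -signExp a b := by
    simp only [signExp, Pi.neg_apply]; ring
  simp only [sgnF, this, Int.negOnePow_neg]

theorem sgnF_neg_right (a b : Lattice) : sgnF a (-b) = sgnF a b := by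
  have : signExp a (-b) = -signExp a b := by
    simp only [signExp, Pi.neg_apply]; ring
  simp only [sgnF, this, Int.negOnePow_neg]

theorem sgnF_mul_self (a b : Lattice) : sgnF a b * sgnF a b = 1 := by
  simp only [sgnF]
  rcases Int.units_eq_one_or (signExp a b).negOnePow with h | h <;> simp [h]


theorem signExp_swap (a b : Lattice) : signExp a b + signExp b a + form a b =
    2 * (2 * (a 0 * b 0 + a 1 * b 1 + a 2 * b 2 + a 3 * b 3 + a 4 * b 4 + a 5 * b 5)) := by
  simp only [signExp, form]; ring

theorem sgnF_swap_even (a b : Lattice) (h : Even (form a b)) : sgnF b a = sgnF a b := by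
  have h1 := signExp_swap a b
  have : (signExp b a).negOnePow = (signExp a b).negOnePow := by
    rw [Int.negOnePow_eq_iff]
    obtain ⟨r, hr⟩ := h
    generalize 2 * (_ + _ : ℤ) = z at h1
    exact ⟨z - r - signExp a b, by linarith⟩
  simp only [sgnF, this]

theorem sgnF_swap_odd (a b : Lattice) (h : Odd (form a b)) : sgnF b a = -sgnF a b := by
  have h1 := signExp_swap a b
  have : (signExp b a).negOnePow = (signExp a b + 1).negOnePow := by
    rw [Int.negOnePow_eq_iff]
    obtain ⟨r, hr⟩ := h
    generalize 2 * (_ + _ : ℤ) = z at h1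
    exact ⟨z - r - 1 - signExp a b, by linarith⟩
  simp only [sgnF, this, Int.negOnePow_succ]; push_cast; ring

theorem sgnF_self (a : Lattice) (h : form a a = 2) : sgnF a a = -1 := by
  have h1 : Odd (signExp a a) := by
    refine ⟨a 0 * a 2 + a 3 * a 1 + a 2 * a 3 + a 4 * a 3 + a 5 * a 4, ?_⟩
    simp only [form, signExp] at *
    linarith
  simp only [sgnF, Int.negOnePow_odd _ h1]; norm_num

theorem form_add_self (a b : Lattice) (ha : form a a = 2) (hb : form b b = 2) :
    form (a + b) (a + b) = 4 + 2 * form a b := by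
  rw [form_add_left, form_add_right, form_add_right, form_comm b a, ha, hb]; ring

theorem neg_two_le_form (a b : Lattice) (ha : form a a = 2) (hb : form b b = 2) :
    -2 ≤ form a b := by
  have := form_nonneg (a + b)
  rw [form_add_self a b ha hb] at this
  omega

theorem form_le_two (a b : Lattice) (ha : form a a = 2) (hb : form b b = 2) : form a b ≤ 2 := by
  have := neg_two_le_form a (-b) ha (by rw [form_neg_left, form_neg_right, neg_neg, hb])
  rw [form_neg_right] at this
  omega

theorem add_eq_zero_iff (a b : Lattice) (ha : form a a = 2) (hb : form b b = 2) :
    a + b = 0 ↔ form a b = -2 := by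
  have h := form_add_self a b ha hb
  constructor
  · intro h0
    rw [h0] at h
    simp [form] at h ⊢
    omega
  · intro h0
    exact eq_zero_of_form _ (by rw [h, h0]; norm_num)

theorem E_of_root (v : Lattice) (h : form v v = 2) :
    E v = ofR (Finsupp.single (⟨v, h⟩ : Root) 1) := dif_pos h

theorem E_of_not_root (v : Lattice) (h : form v v ≠ 2) : E v = 0 := dif_neg h

@[simp] theorem hPart_ofH (h : Fin 6 → ℂ) : hPart (ofH h) = h := rfl
@[simp] theorem rPart_ofH (h : Fin 6 → ℂ) : rPart (ofH h) = 0 := rfl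
@[simp] theorem hPart_ofR (a : Root →₀ ℂ) : hPart (ofR a) = 0 := rfl
@[simp] theorem rPart_ofR (a : Root →₀ ℂ) : rPart (ofR a) = a := rfl

@[simp] theorem hPart_E (v : Lattice) : hPart (E v) = 0 := by
  unfold E; split_ifs <;> simp

theorem ofH_add_ofR (x : G) : ofH (hPart x) + ofR (rPart x) = x := by
  refine Prod.ext ?_ ?_
  · exact add_zero _
  · exact zero_add _

theorem bracketHR_add (h k : Fin 6 → ℂ) : bracketHR (h + k) = bracketHR h + bracketHR k := by
  refine Finsupp.lhom_ext' fun b => LinearMap.ext_ring ?_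
  simp [bracketHR, form_add_left, add_smul]

theorem bracketHR_smul (r : ℂ) (h : Fin 6 → ℂ) : bracketHR (r • h) = r • bracketHR h := by
  refine Finsupp.lhom_ext' fun b => LinearMap.ext_ring ?_
  simp [bracketHR, form_smul_left, mul_smul]

/-- The bracket as a bilinear map. -/
def bracketL : G →ₗ[ℂ] G →ₗ[ℂ] G :=
  LinearMap.mk₂ ℂ (fun x y => ⁅x, y⁆)
    (fun x y z => by simp only [bracket_def, map_add, bracketHR_add, LinearMap.add_apply]; abel)
    (fun r x y => by
      simp only [bracket_def, map_smul, bracketHR_smul, LinearMap.smul_apply, smul_add, smul_sub])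
    (fun x y z => by simp only [bracket_def, map_add, bracketHR_add, LinearMap.add_apply]; abel)
    (fun r x y => by
      simp only [bracket_def, map_smul, bracketHR_smul, LinearMap.smul_apply, smul_add, smul_sub])

theorem bracketL_apply (x y : G) : bracketL x y = ⁅x, y⁆ := rfl

theorem G_induction {p : G → Prop} (hH : ∀ h, p (ofH h))
    (hE : ∀ a : Lattice, form a a = 2 → p (E a)) (hadd : ∀ x y, p x → p y → p (x + y))
    (hsmul : ∀ (r : ℂ) x, p x → p (r • x)) (x : G) : p x := by
  rw [← ofH_add_ofR x]
  refine hadd _ _ (hH _) ?_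
  induction rPart x using Finsupp.induction_linear with
  | zero => simpa using hH 0
  | add f g hf hg => rw [map_add]; exact hadd _ _ hf hg
  | single a r =>
    have : Finsupp.single a r = r • Finsupp.single a (1 : ℂ) := by simp
    rw [this, map_smul]
    refine hsmul _ _ ?_
    have := hE a.1 a.2
    rwa [E_of_root a.1 a.2] at this

theorem HH (h k : Fin 6 → ℂ) : bracketL (ofH h) (ofH k) = 0 := by
  simp [bracketL_apply, bracket_def]

theorem HE (h : Fin 6 → ℂ) (a : Lattice) :
    bracketL (ofH h) (E a) = form h (toC a) • E a := by
  by_cases ha : form a a = 2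
  · simp [bracketL_apply, bracket_def, E_of_root a ha, bracketHR]
  · simp [E_of_not_root a ha]

theorem EH (h : Fin 6 → ℂ) (a : Lattice) :
    bracketL (E a) (ofH h) = -(form h (toC a) • E a) := by
  by_cases ha : form a a = 2
  · simp [bracketL_apply, bracket_def, E_of_root a ha, bracketHR]
  · simp [E_of_not_root a ha]

theorem EE (a b : Lattice) (ha : form a a = 2) (hb : form b b = 2) :
    bracketL (E a) (E b) = rootBracket a b := by
  simp [bracketL_apply, bracket_def, E_of_root a ha, E_of_root b hb, bracketRR, bracketHR,
    form_zero_left]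

theorem rb_neg (a b : Lattice) (ha : form a a = 2) (hb : form b b = 2) (h : form a b = -2) :
    rootBracket a b = -ofH (toC a) := by
  rw [rootBracket, if_pos ((add_eq_zero_iff a b ha hb).2 h)]

theorem rb_one (a b : Lattice) (ha : form a a = 2) (hb : form b b = 2) (h : form a b = -1) :
    rootBracket a b = sgnF a b • E (a + b) := by
  rw [rootBracket, if_neg (fun h' => by have := (add_eq_zero_iff a b ha hb).1 h'; omega)]

theorem rb_zero (a b : Lattice) (ha : form a a = 2) (hb : form b b = 2) (h : 0 ≤ form a b) :
    rootBracket a b = 0 := by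
  rw [rootBracket, if_neg (fun h' => by have := (add_eq_zero_iff a b ha hb).1 h'; omega),
    E_of_not_root, smul_zero]
  rw [form_add_self a b ha hb]; omega

theorem rb_skew (a b : Lattice) (ha : form a a = 2) (hb : form b b = 2) :
    rootBracket a b = -rootBracket b a := by
  have hc := form_comm a b
  have h0 := neg_two_le_form a b ha hb
  rcases (by omega : form a b = -2 ∨ form a b = -1 ∨ 0 ≤ form a b) with h | h | h
  · have hb' : b = -a := (neg_eq_of_add_eq_zero_right ((add_eq_zero_iff a b ha hb).2 h)).symm
    rw [rb_neg a b ha hb h, rb_neg b a hb ha (by omega), hb', toC_neg, map_neg, neg_neg]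
  · rw [rb_one a b ha hb h, rb_one b a hb ha (by omega), add_comm b a,
      sgnF_swap_odd a b (by rw [h]; decide), neg_smul, neg_neg]
  · rw [rb_zero a b ha hb h, rb_zero b a hb ha (by omega), neg_zero]

theorem bracketL_skew (x y : G) : bracketL x y = -bracketL y x := by
  induction x using G_induction with
  | hadd x x' hx hx' => simp only [map_add, LinearMap.add_apply, hx, hx', neg_add]
  | hsmul r x hx => simp only [map_smul, LinearMap.smul_apply, hx, smul_neg]
  | hH h =>
    induction y using G_induction with
    | hadd x x' hx hx' => simp only [map_add, LinearMap.add_apply, hx, hx', neg_add]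
    | hsmul r x hx => simp only [map_smul, LinearMap.smul_apply, hx, smul_neg]
    | hH k => simp [HH]
    | hE a ha => rw [HE, EH, neg_neg]
  | hE a ha =>
    induction y using G_induction with
    | hadd x x' hx hx' => simp only [map_add, LinearMap.add_apply, hx, hx', neg_add]
    | hsmul r x hx => simp only [map_smul, LinearMap.smul_apply, hx, smul_neg]
    | hH k => rw [HE, EH]
    | hE b hb => rw [EE a b ha hb, EE b a hb ha, rb_skew a b ha hb]

theorem bracketL_self (x : G) : bracketL x x = 0 := by
  have h := bracketL_skew x x
  have h2 : (2 : ℂ) • bracketL x x = 0 := by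
    rw [two_smul]; nth_rewrite 1 [h]; exact neg_add_cancel _
  exact (smul_eq_zero.mp h2).resolve_left two_ne_zero

/-- The Jacobi defect. -/
def jac (x y z : G) : G :=
  bracketL x (bracketL y z) - bracketL (bracketL x y) z - bracketL y (bracketL x z)

theorem jac_swap (x y z : G) : jac x y z = -jac y x z := by
  simp only [jac, bracketL_skew x y, map_neg, LinearMap.neg_apply]; abel

theorem jac_swap' (x y z : G) : jac x y z = -jac x z y := by
  simp only [jac]
  rw [bracketL_skew y z, bracketL_skew (bracketL x y) z, bracketL_skew y (bracketL x z)]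
  simp only [map_neg]; abel

theorem jac_H (h : Fin 6 → ℂ) (y z : G) : jac (ofH h) y z = 0 := by
  induction y using G_induction with
  | hadd x x' hx hx' =>
    have : jac (ofH h) (x + x') z = jac (ofH h) x z + jac (ofH h) x' z := by
      simp only [jac, map_add, LinearMap.add_apply]; abel
    rw [this, hx, hx', add_zero]
  | hsmul r x hx =>
    have : jac (ofH h) (r • x) z = r • jac (ofH h) x z := by
      simp only [jac, map_smul, LinearMap.smul_apply, smul_sub]
    rw [this, hx, smul_zero]
  | hH k =>
    induction z using G_induction with
    | hadd x x' hx hx' =>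
      have : jac (ofH h) (ofH k) (x + x') = jac (ofH h) (ofH k) x + jac (ofH h) (ofH k) x' := by
        simp only [jac, map_add]; abel
      rw [this, hx, hx', add_zero]
    | hsmul r x hx =>
      have : jac (ofH h) (ofH k) (r • x) = r • jac (ofH h) (ofH k) x := by
        simp only [jac, map_smul, smul_sub]
      rw [this, hx, smul_zero]
    | hH l => simp [jac, HH]
    | hE a ha =>
      simp only [jac, HH, HE, map_smul, smul_smul, map_zero, LinearMap.zero_apply]
      rw [mul_comm]; simp
  | hE a ha =>
    induction z using G_induction with
    | hadd x x' hx hx' =>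
      have : jac (ofH h) (E a) (x + x') = jac (ofH h) (E a) x + jac (ofH h) (E a) x' := by
        simp only [jac, map_add]; abel
      rw [this, hx, hx', add_zero]
    | hsmul r x hx =>
      have : jac (ofH h) (E a) (r • x) = r • jac (ofH h) (E a) x := by
        simp only [jac, map_smul, smul_sub]
      rw [this, hx, smul_zero]
    | hH l =>
      simp only [jac, HH, HE, EH, map_smul, map_neg, LinearMap.smul_apply, smul_smul, map_zero,
        smul_neg]
      rw [mul_comm]; simp
    | hE b hb =>
      simp only [jac, HE, map_smul, LinearMap.smul_apply, EE a b ha hb]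
      have key : bracketL (ofH h) (rootBracket a b)
          = (form h (toC a) + form h (toC b)) • rootBracket a b := by
        rw [← form_add_right, ← toC_add]
        unfold rootBracket
        split_ifs with h0
        · rw [h0]; simp [HH, form, toC]
        · rw [map_smul, HE, smul_comm]
      rw [key, add_smul]; abel

theorem jac_neg (a b : Lattice) (ha : form a a = 2) (hb : form b b = 2) :
    jac (E a) (E b) (E (-b)) = 0 := by
  have hb' : form (-b) (-b) = 2 := by rw [form_neg_left, form_neg_right, neg_neg, hb]
  have hbb : form b (-b) = -2 := by rw [form_neg_right, hb]
  have hr : form a (-b) = -form a b := form_neg_right a b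
  have h1 := neg_two_le_form a b ha hb
  have h2 := form_le_two a b ha hb
  simp only [jac, EE b (-b) hb hb', EE a b ha hb, EE a (-b) ha hb', rb_neg b (-b) hb hb' hbb,
    map_neg, EH, form_toC, form_comm b a]
  rcases (by omega : form a b = -2 ∨ form a b = -1 ∨ form a b = 0 ∨ form a b = 1 ∨ form a b = 2)
    with h | h | h | h | h
  · have hab : b = -a := (neg_eq_of_add_eq_zero_right ((add_eq_zero_iff a b ha hb).2 h)).symm
    rw [rb_neg a b ha hb h, rb_zero a (-b) ha hb' (by omega)]
    subst hab
    simp only [neg_neg, map_neg, LinearMap.neg_apply, HE, map_zero, form_toC, ha, h]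
    push_cast; module
  · have hs : form (a + b) (a + b) = 2 := by rw [form_add_self a b ha hb]; omega
    rw [rb_one a b ha hb h, rb_zero a (-b) ha hb' (by omega), map_smul, LinearMap.smul_apply,
      EE _ _ hs hb', rb_one _ _ hs hb' (by rw [form_add_left]; omega), add_neg_cancel_right,
      sgnF_neg_right, sgnF_add_left, sgnF_self b hb, smul_smul, ← mul_assoc, sgnF_mul_self, h]
    simp
  · rw [rb_zero a b ha hb (by omega), rb_zero a (-b) ha hb' (by omega), h]
    simp
  · have hs : form (a + -b) (a + -b) = 2 := by rw [form_add_self a (-b) ha hb']; omega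
    have e : b + (a + -b) = a := by abel
    rw [rb_zero a b ha hb (by omega), rb_one a (-b) ha hb' (by omega), map_smul,
      EE _ _ hb hs, rb_one _ _ hb hs (by rw [form_add_right, form_comm b a]; omega), e,
      sgnF_neg_right, sgnF_add_right, sgnF_neg_right, sgnF_self b hb, smul_smul,
      sgnF_swap_odd a b (by rw [h]; decide), h]
    have := sgnF_mul_self a b
    have e2 : sgnF a b * (-sgnF a b * -1) = 1 := by linear_combination this
    rw [e2]
    simp
  · have hab : a = b := by
      have := (add_eq_zero_iff a (-b) ha hb').2 (by omega)
      exact add_neg_eq_zero.mp this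
    rw [rb_zero a b ha hb (by omega), rb_neg a (-b) ha hb' (by omega)]
    subst hab
    simp only [map_neg, EH, map_zero, LinearMap.zero_apply, form_toC, ha]
    push_cast; module

theorem jac_EEE (a b c : Lattice) (ha : form a a = 2) (hb : form b b = 2) (hc : form c c = 2) :
    jac (E a) (E b) (E c) = 0 := by
  have p0 := neg_two_le_form a b ha hb
  have q0 := neg_two_le_form b c hb hc
  have r0 := neg_two_le_form a c ha hc
  by_cases hq : form b c = -2
  · have : c = -b := (neg_eq_of_add_eq_zero_right ((add_eq_zero_iff b c hb hc).2 hq)).symm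
    rw [this]; exact jac_neg a b ha hb
  by_cases hr : form a c = -2
  · have : c = -a := (neg_eq_of_add_eq_zero_right ((add_eq_zero_iff a c ha hc).2 hr)).symm
    rw [this, jac_swap, jac_neg b a hb ha, neg_zero]
  by_cases hp : form a b = -2
  · have : b = -a := (neg_eq_of_add_eq_zero_right ((add_eq_zero_iff a b ha hb).2 hp)).symm
    rw [this, jac_swap', jac_swap, neg_neg, jac_neg c a hc ha]
  have p1 : -1 ≤ form a b := by omega
  have q1 : -1 ≤ form b c := by omega
  have r1 : -1 ≤ form a c := by omega
  clear p0 q0 r0 hp hq hr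
  have hba := form_comm b a
  have hcb := form_comm c b
  have hca := form_comm c a
  -- the three double brackets
  have A : form b c = -1 → bracketL (E a) (bracketL (E b) (E c))
      = sgnF b c • rootBracket a (b + c) := fun h => by
    rw [EE b c hb hc, rb_one b c hb hc h, map_smul, EE a _ ha (by
      rw [form_add_self b c hb hc]; omega)]
  have B : form a b = -1 → bracketL (bracketL (E a) (E b)) (E c)
      = sgnF a b • rootBracket (a + b) c := fun h => by
    rw [EE a b ha hb, rb_one a b ha hb h, map_smul, LinearMap.smul_apply, EE _ c (by
      rw [form_add_self a b ha hb]; omega) hc]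
  have C : form a c = -1 → bracketL (E b) (bracketL (E a) (E c))
      = sgnF a c • rootBracket b (a + c) := fun h => by
    rw [EE a c ha hc, rb_one a c ha hc h, map_smul, EE b _ hb (by
      rw [form_add_self a c ha hc]; omega)]
  have A0 : 0 ≤ form b c ∨ 0 ≤ form a b + form a c →
      bracketL (E a) (bracketL (E b) (E c)) = 0 := fun h => by
    by_cases h' : 0 ≤ form b c
    · rw [EE b c hb hc, rb_zero b c hb hc h', map_zero]
    · rw [A (by omega), rb_zero _ _ ha (by rw [form_add_self b c hb hc]; omega)
        (by rw [form_add_right]; omega), smul_zero]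
  have B0 : 0 ≤ form a b ∨ 0 ≤ form a c + form b c →
      bracketL (bracketL (E a) (E b)) (E c) = 0 := fun h => by
    by_cases h' : 0 ≤ form a b
    · rw [EE a b ha hb, rb_zero a b ha hb h', map_zero, LinearMap.zero_apply]
    · rw [B (by omega), rb_zero _ _ (by rw [form_add_self a b ha hb]; omega) hc
        (by rw [form_add_left]; omega), smul_zero]
  have C0 : 0 ≤ form a c ∨ 0 ≤ form a b + form b c →
      bracketL (E b) (bracketL (E a) (E c)) = 0 := fun h => by
    by_cases h' : 0 ≤ form a c
    · rw [EE a c ha hc, rb_zero a c ha hc h', map_zero]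
    · rw [C (by omega), rb_zero _ _ hb (by rw [form_add_self a c ha hc]; omega)
        (by rw [form_add_right, hba]; omega), smul_zero]
  have A1 : form b c = -1 → form a b + form a c = -1 → bracketL (E a) (bracketL (E b) (E c))
      = (sgnF b c * (sgnF a b * sgnF a c)) • E (a + b + c) := fun h h' => by
    rw [A h, rb_one _ _ ha (by rw [form_add_self b c hb hc]; omega)
      (by rw [form_add_right]; omega), sgnF_add_right, smul_smul, add_assoc]
  have B1 : form a b = -1 → form a c + form b c = -1 → bracketL (bracketL (E a) (E b)) (E c)
      = (sgnF a b * (sgnF a c * sgnF b c)) • E (a + b + c) := fun h h' => by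
    rw [B h, rb_one _ _ (by rw [form_add_self a b ha hb]; omega) hc
      (by rw [form_add_left]; omega), sgnF_add_left, smul_smul]
  have C1 : form a c = -1 → form a b + form b c = -1 → bracketL (E b) (bracketL (E a) (E c))
      = (sgnF a c * (sgnF b a * sgnF b c)) • E (a + b + c) := fun h h' => by
    rw [C h, rb_one _ _ hb (by rw [form_add_self a c ha hc]; omega)
      (by rw [form_add_right, hba]; omega), sgnF_add_right, smul_smul,
      add_left_comm b a c, add_assoc]
  unfold jac
  rcases (by omega : (form a b = -1 ∧ form b c = -1 ∧ form a c = -1)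
      ∨ (form a b = -1 ∧ form b c = -1 ∧ form a c = 0)
      ∨ (form a b = 0 ∧ form b c = -1 ∧ form a c = -1)
      ∨ (form a b = -1 ∧ form b c = 0 ∧ form a c = -1)
      ∨ ((0 ≤ form b c ∨ 0 ≤ form a b + form a c) ∧ (0 ≤ form a b ∨ 0 ≤ form a c + form b c)
        ∧ (0 ≤ form a c ∨ 0 ≤ form a b + form b c)))
    with ⟨p, q, r⟩ | ⟨p, q, r⟩ | ⟨p, q, r⟩ | ⟨p, q, r⟩ | ⟨h1, h2, h3⟩
  · have hs : form (a + b) (a + b) = 2 := by rw [form_add_self a b ha hb]; omega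
    have hsum : c = -(a + b) := (neg_eq_of_add_eq_zero_right
      ((add_eq_zero_iff (a + b) c hs hc).2 (by rw [form_add_left]; omega))).symm
    rw [A q, B p, C r, rb_neg _ _ ha (by rw [form_add_self b c hb hc]; omega)
      (by rw [form_add_right]; omega), rb_neg _ _ hs hc (by rw [form_add_left]; omega),
      rb_neg _ _ hb (by rw [form_add_self a c ha hc]; omega)
      (by rw [form_add_right, hba]; omega)]
    rw [hsum, sgnF_neg_right, sgnF_neg_right, sgnF_add_right, sgnF_add_right, sgnF_self a ha,
      sgnF_self b hb, sgnF_swap_odd a b (by rw [p]; decide), toC_add, map_add]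
    module
  · rw [A1 q (by omega), B1 p (by omega), C0 (by omega)]
    module
  · rw [A1 q (by omega), B0 (by omega), C1 r (by omega), sgnF_swap_even a b (by rw [p]; decide)]
    module
  · rw [A0 (by omega), B1 p (by omega), C1 r (by omega), sgnF_swap_odd a b (by rw [p]; decide)]
    module
  · rw [A0 h1, B0 h2, C0 h3]; simp

theorem jac_zero (x y z : G) : jac x y z = 0 := by
  induction x using G_induction with
  | hadd x x' hx hx' =>
    have : jac (x + x') y z = jac x y z + jac x' y z := by
      simp only [jac, map_add, LinearMap.add_apply]; abel
    rw [this, hx, hx', add_zero]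
  | hsmul r x hx =>
    have : jac (r • x) y z = r • jac x y z := by
      simp only [jac, map_smul, LinearMap.smul_apply, smul_sub]
    rw [this, hx, smul_zero]
  | hH h => exact jac_H h y z
  | hE a ha =>
    induction y using G_induction with
    | hadd x x' hx hx' =>
      have : jac (E a) (x + x') z = jac (E a) x z + jac (E a) x' z := by
        simp only [jac, map_add, LinearMap.add_apply]; abel
      rw [this, hx, hx', add_zero]
    | hsmul r x hx =>
      have : jac (E a) (r • x) z = r • jac (E a) x z := by
        simp only [jac, map_smul, LinearMap.smul_apply, smul_sub]
      rw [this, hx, smul_zero]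
    | hH h => rw [jac_swap, jac_H, neg_zero]
    | hE b hb =>
      induction z using G_induction with
      | hadd x x' hx hx' =>
        have : jac (E a) (E b) (x + x') = jac (E a) (E b) x + jac (E a) (E b) x' := by
          simp only [jac, map_add]; abel
        rw [this, hx, hx', add_zero]
      | hsmul r x hx =>
        have : jac (E a) (E b) (r • x) = r • jac (E a) (E b) x := by
          simp only [jac, map_smul, smul_sub]
        rw [this, hx, smul_zero]
      | hH h => rw [jac_swap', jac_swap, jac_H, neg_zero, neg_zero]
      | hE c hc => exact jac_EEE a b c ha hb hc

/-- The simple Lie algebra of type `E₆`. -/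
instance : LieRing G where
  add_lie x y z := by simp only [← bracketL_apply, map_add, LinearMap.add_apply]
  lie_add x y z := by simp only [← bracketL_apply, map_add]
  lie_self x := bracketL_self x
  leibniz_lie x y z := by
    have := jac_zero x y z
    simp only [jac, bracketL_apply] at this
    rw [sub_sub, sub_eq_zero] at this
    exact this

instance : LieAlgebra ℂ G where
  lie_smul r x y := by simp only [← bracketL_apply, map_smul]

/-! ### The subalgebra of type `D₅` -/

/-- The span of `α₁, …, α₅` and of the `E_β` with `β` a root in `ℤα₁ ⊕ ⋯ ⊕ ℤα₅`. -/
def D5Space : Submodule ℂ G where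
  carrier := {x | hPart x 5 = 0 ∧ ∀ a : Root, a.1 5 ≠ 0 → rPart x a = 0}
  zero_mem' := by simp
  add_mem' := by
    rintro x y ⟨hx, hx'⟩ ⟨hy, hy'⟩
    exact ⟨by simp [hx, hy], fun a ha => by simp [hx' a ha, hy' a ha]⟩
  smul_mem' := by
    rintro r x ⟨hx, hx'⟩
    exact ⟨by simp [hx], fun a ha => by simp [hx' a ha]⟩

theorem ofH_mem_D5Space (h : Fin 6 → ℂ) (h5 : h 5 = 0) : ofH h ∈ D5Space :=
  ⟨h5, fun _ _ => by simp⟩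

theorem E_mem_D5Space (v : Lattice) (h5 : v 5 = 0) : E v ∈ D5Space := by
  by_cases hv : form v v = 2
  · refine ⟨by simp, fun a ha => ?_⟩
    rw [E_of_root v hv, rPart_ofR, Finsupp.single_apply, if_neg]
    rintro rfl
    exact ha h5
  · rw [E_of_not_root v hv]; exact D5Space.zero_mem

theorem rootBracket_mem_D5Space (a b : Lattice) (ha : a 5 = 0) (hb : b 5 = 0) :
    rootBracket a b ∈ D5Space := by
  unfold rootBracket
  split_ifs
  · exact D5Space.neg_mem (ofH_mem_D5Space _ (by simp [toC, ha]))
  · exact D5Space.smul_mem _ (E_mem_D5Space _ (by simp [ha, hb]))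

theorem bracketHR_mem_D5Space (h : Fin 6 → ℂ) (y : G) (hy : y ∈ D5Space) :
    bracketHR h (rPart y) ∈ D5Space := by
  rw [bracketHR, Finsupp.linearCombination_apply]
  refine D5Space.sum_mem fun a ha => D5Space.smul_mem _ (D5Space.smul_mem _ (E_mem_D5Space _ ?_))
  by_contra h5
  exact (Finsupp.mem_support_iff.mp ha) (hy.2 a h5)

theorem bracketRR_mem_D5Space (x y : G) (hx : x ∈ D5Space) (hy : y ∈ D5Space) :
    bracketRR (rPart x) (rPart y) ∈ D5Space := by
  rw [bracketRR, Finsupp.linearCombination_apply, Finsupp.sum, LinearMap.sum_apply]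
  refine D5Space.sum_mem fun a ha => ?_
  rw [LinearMap.smul_apply, Finsupp.linearCombination_apply]
  refine D5Space.smul_mem _ (D5Space.sum_mem fun b hb => D5Space.smul_mem _
    (rootBracket_mem_D5Space _ _ ?_ ?_))
  · by_contra h5
    exact (Finsupp.mem_support_iff.mp ha) (hx.2 a h5)
  · by_contra h5
    exact (Finsupp.mem_support_iff.mp hb) (hy.2 b h5)

/-- The Lie subalgebra of type `D₅`, a copy of the orthogonal Lie algebra `o(10, ℂ)`. -/
def D5 : LieSubalgebra ℂ G :=
  { D5Space with
    lie_mem' := by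
      intro x y hx hy
      change ⁅x, y⁆ ∈ D5Space
      rw [bracket_def]
      exact D5Space.add_mem (D5Space.sub_mem (bracketHR_mem_D5Space _ y hy)
        (bracketHR_mem_D5Space _ x hx)) (bracketRR_mem_D5Space x y hx hy) }

/-! ### The grading `G = G₋ ⊕ G₀ ⊕ G₊` -/

/-- The sixteen positive roots outside `D₅`, in the order of the root vectors `ξ₁, …, ξ₁₆`. -/
def xiRoot : Fin 16 → Lattice :=
  ![![0, 0, 0, 0, 0, 1], ![0, 0, 0, 0, 1, 1], ![0, 0, 0, 1, 1, 1], ![0, 0, 1, 1, 1, 1],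
    ![0, 1, 0, 1, 1, 1], ![0, 1, 1, 1, 1, 1], ![1, 0, 1, 1, 1, 1], ![1, 1, 1, 1, 1, 1],
    ![0, 1, 1, 2, 1, 1], ![1, 1, 1, 2, 1, 1], ![0, 1, 1, 2, 2, 1], ![1, 1, 2, 2, 1, 1],
    ![1, 1, 1, 2, 2, 1], ![1, 1, 2, 2, 2, 1], ![1, 1, 2, 3, 2, 1], ![1, 2, 2, 3, 2, 1]]

/-- The basis `ξ₁, …, ξ₁₆` of `G₊`. -/
def xi (i : Fin 16) : G := E (xiRoot i)

/-- The basis `η₁, …, η₁₆` of `G₋`. -/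
def eta (i : Fin 16) : G := E (-xiRoot i)

/-- The coefficient of `E_v` in `y`, for a root `v`. -/
def coeffE (v : Lattice) (y : G) : ℂ :=
  if h : form v v = 2 then rPart y ⟨v, h⟩ else 0

/-- The component in `G₀ = D₅ ⊕ ℂα₆`. -/
def zeroPart (g : G) : G :=
  ofH (hPart g) + ofR ((rPart g).filter fun a : Root => a.1 5 = 0)

/-- The element `α̂ = 2α₁ + 3α₂ + 4α₃ + 6α₄ + 5α₅ + 4α₆`, which spans the centre of `G₀`. -/
def alphaHat : Fin 6 → ℂ := ![2, 3, 4, 6, 5, 4]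

/-- The coefficient of `α̂` in the decomposition `G₀ = D₅ ⊕ ℂα̂`. -/
def hatCoeff (u : G) : ℂ := hPart u 5 / 4

/-- The component in `D₅` in the decomposition `G₀ = D₅ ⊕ ℂα̂`. -/
def d5Part (u : G) : D5 :=
  ⟨ofH (hPart u - hatCoeff u • alphaHat) + ofR ((rPart u).filter fun a : Root => a.1 5 = 0), by
    constructor
    · have h : alphaHat 5 = 4 := rfl
      simp [hatCoeff, h]
    · intro a ha
      simp [ha]⟩

/-! ### Differential operators on the polynomial algebra -/

/-- The polynomial algebra `ℂ[x₁, …, x₁₆]`; the variable `x_{i+1}` is `X i`. -/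
abbrev A : Type := MvPolynomial (Fin 16) ℂ

/-- The variable `xₙ`, for `1 ≤ n ≤ 16`. -/
def x (n : ℕ) : A := MvPolynomial.X (Fin.ofNat 16 (n - 1))

/-- The partial derivative with respect to `xₙ`, for `1 ≤ n ≤ 16`. -/
def dx (n : ℕ) : Derivation ℂ A A := MvPolynomial.pderiv (Fin.ofNat 16 (n - 1))

/-- The degree operator `∑ xᵢ ∂ᵢ`. -/
def deg : Derivation ℂ A A :=
  ∑ i : Fin 16, (MvPolynomial.X i : A) • MvPolynomial.pderiv i

/-- The action of `u ∈ G₀` on the polynomial algebra: if `[u, ηᵢ] = ∑ⱼ φᵢⱼ ηⱼ`, then `u` acts as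
`∑ᵢⱼ φᵢⱼ xⱼ ∂ᵢ`. -/
def actA (u : G) : Derivation ℂ A A :=
  ∑ i : Fin 16, ∑ j : Fin 16, coeffE (-xiRoot j) ⁅u, eta i⁆ •
    ((MvPolynomial.X j : A) • MvPolynomial.pderiv i)

/-- The quadratic polynomials `ζ₁, …, ζ₁₀`. -/
def zeta : ℕ → A
  | 1 => x 1 * x 11 + x 2 * x 9 - x 3 * x 6 + x 4 * x 5
  | 2 => x 1 * x 13 + x 2 * x 10 - x 3 * x 8 + x 5 * x 7
  | 3 => x 1 * x 14 + x 2 * x 12 - x 4 * x 8 + x 6 * x 7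
  | 4 => x 1 * x 15 - x 3 * x 12 + x 4 * x 10 - x 7 * x 9
  | 5 => -(x 2 * x 15) - x 3 * x 14 + x 4 * x 13 - x 7 * x 11
  | 6 => x 7 * x 16 + x 8 * x 15 + x 10 * x 14 - x 12 * x 13
  | 7 => -(x 4 * x 16) - x 6 * x 15 - x 9 * x 14 + x 11 * x 12
  | 8 => x 3 * x 16 + x 5 * x 15 + x 9 * x 13 - x 10 * x 11
  | 9 => x 2 * x 16 - x 5 * x 14 + x 6 * x 13 - x 8 * x 11
  | 10 => x 1 * x 16 + x 5 * x 12 - x 6 * x 10 + x 8 * x 9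
  | _ => 0

/-- The differential operators `P₁, …, P₁₆` by which `η₁, …, η₁₆` act on the polynomial algebra in
the untwisted realization of `E₆`. -/
def P : Fin 16 → Derivation ℂ A A :=
  ![x 1 • deg - zeta 1 • dx 11 - zeta 2 • dx 13 - zeta 3 • dx 14
      - zeta 4 • dx 15 - zeta 10 • dx 16,
    x 2 • deg - zeta 1 • dx 9 - zeta 2 • dx 10 - zeta 3 • dx 12
      + zeta 5 • dx 15 - zeta 9 • dx 16,
    x 3 • deg + zeta 1 • dx 6 + zeta 2 • dx 8 + zeta 4 • dx 12
      + zeta 5 • dx 14 - zeta 8 • dx 16,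
    x 4 • deg - zeta 1 • dx 5 + zeta 3 • dx 8 - zeta 4 • dx 10
      - zeta 5 • dx 13 + zeta 7 • dx 16,
    x 5 • deg - zeta 1 • dx 4 - zeta 2 • dx 7 - zeta 10 • dx 12
      + zeta 9 • dx 14 - zeta 8 • dx 15,
    x 6 • deg + zeta 1 • dx 3 - zeta 3 • dx 7 + zeta 10 • dx 10
      - zeta 9 • dx 13 + zeta 7 • dx 15,
    x 7 • deg - zeta 2 • dx 5 - zeta 3 • dx 6 + zeta 4 • dx 9
      + zeta 5 • dx 11 - zeta 6 • dx 16,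
    x 8 • deg + zeta 2 • dx 3 + zeta 3 • dx 4 - zeta 10 • dx 9
      + zeta 9 • dx 11 - zeta 6 • dx 15,
    x 9 • deg - zeta 1 • dx 2 + zeta 4 • dx 7 - zeta 10 • dx 8
      - zeta 8 • dx 13 + zeta 7 • dx 14,
    x 10 • deg - zeta 2 • dx 2 - zeta 4 • dx 4 + zeta 10 • dx 6
      + zeta 8 • dx 11 - zeta 6 • dx 14,
    x 11 • deg - zeta 1 • dx 1 + zeta 5 • dx 7 + zeta 9 • dx 8
      + zeta 8 • dx 10 - zeta 7 • dx 12,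
    x 12 • deg - zeta 3 • dx 2 + zeta 4 • dx 3 - zeta 10 • dx 5
      - zeta 7 • dx 11 + zeta 6 • dx 13,
    x 13 • deg - zeta 2 • dx 1 - zeta 5 • dx 4 - zeta 9 • dx 6
      - zeta 8 • dx 9 + zeta 6 • dx 12,
    x 14 • deg - zeta 3 • dx 1 + zeta 5 • dx 3 + zeta 9 • dx 5
      + zeta 7 • dx 9 - zeta 6 • dx 10,
    x 15 • deg - zeta 4 • dx 1 + zeta 5 • dx 2 - zeta 8 • dx 5
      + zeta 7 • dx 6 - zeta 6 • dx 8,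
    x 16 • deg - zeta 10 • dx 1 - zeta 9 • dx 2 - zeta 8 • dx 3
      + zeta 7 • dx 4 - zeta 6 • dx 7]

/-! ### The functor from `D₅`-modules to `E₆`-modules -/

section Functor

variable {M : Type*} [AddCommGroup M] [Module ℂ M] [LieRingModule D5 M] [LieModule ℂ D5 M]

/-- The action of `G₀ = D₅ ⊕ ℂα̂` on `M` in which `α̂` acts as the scalar `2c`. -/
def rho (c : ℂ) (u : G) : M →ₗ[ℂ] M :=
  LieModule.toEnd ℂ D5 M (d5Part u) + (hatCoeff u * (2 * c)) • LinearMap.id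

/-- The operator by which `g` acts on `ℂ[x₁, …, x₁₆] ⊗ M`: an element `u` of `G₀` acts as
`u|_A ⊗ 1 + 1 ⊗ ρ(u)`, `ξᵢ` acts as `∂ᵢ ⊗ 1`, and `ηᵢ` acts as
`Pᵢ ⊗ 1 + ∑ᵣ xᵣ ⊗ ρ([ξᵣ, ηᵢ])`. -/
def iota (c : ℂ) (g : G) : A ⊗[ℂ] M →ₗ[ℂ] A ⊗[ℂ] M :=
  LinearMap.rTensor M (actA (zeroPart g)).toLinearMap
    + LinearMap.lTensor A (rho c (zeroPart g))
    + ∑ i : Fin 16, coeffE (xiRoot i) g •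
        LinearMap.rTensor M (MvPolynomial.pderiv i : Derivation ℂ A A).toLinearMap
    + ∑ i : Fin 16, coeffE (-xiRoot i) g •
        (LinearMap.rTensor M (P i).toLinearMap
          + ∑ r : Fin 16, TensorProduct.map (LinearMap.mulLeft ℂ (MvPolynomial.X r : A))
              (rho c ⁅xi r, eta i⁆))

end Functor

end E6

end

noncomputable section

namespace E6

open MvPolynomial

/-! ### The roots of degree one -/

/-! When `M` is trivial and one-dimensional, only the `α̂`-component of `G₀` acts on it, and `[ξ_r,
η_i]` acts as the scalar `-c/2` if `r = i` and as `0` otherwise. The module is therefore `ℂ[x₁, …,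
x₁₆]`, with `g` acting by a first-order operator `op c g`: the vector field `vfield g` plus
multiplication by a polynomial `twist c g` of degree at most one.

This is a representation because `vfield` is a homomorphism of Lie algebras (`vfield_lie`) and
`twist c` is a 1-cocycle for it (`twist_lie`). A vector field that vanishes at the origin and
commutes with every `∂_r` is zero. So `vfield_lie` follows, by descending induction on degrees, from
the brackets with the `ξ_r`. The substantial case is `[ξ_r, η_i]`, where `∂_r P_i(x_j)`
(`pderiv_P_X`) must agree with the triple product `[[ξ_r, η_i], η_j]` (`lie_lie_eta`). Both sides
are governed by the ten quadrics `ζ_v`: the roots `β_i`, `β_j` are orthogonal exactly when `x_i x_j`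
occurs in some `ζ_v`. The tables `partner` and `pairSgn` record this pairing and its signs.

For irreducibility, let `U` be a nonzero invariant subspace. The `ξ_i` differentiate, so `1 ∈ U`. To
climb back, suppose that `U` contains all forms of degree `n`, and apply the `η_i` to suitable
families of such forms. For `g` of degree `m`, `∑ η_i(∂_iζ_v · g) = (m - 6 - c) ζ_v g`
(`sum_op_eta_pderiv_zeta_mul`). With `m = n - 1` this puts every form of degree `n + 1` in the ideal
of the quadrics into `U`. For `f` of degree `n + 1`, `∑ η_i(∂_i f) = (n + 1)(n - c/2) f` modulo that
ideal (`sum_op_eta_pderiv`). The scalars vanish only for `c = m - 6` or `c = 2n = (2n + 6) - 6`, and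
these are the excluded values. The constant `-6` is `2 - 8`: the degree of a quadric minus the
number of variables in it. The first identity also needs the linear relations between the `ζ_v`
(`sum_zeta_mul_X`). -/

/-- The sixteen weights of a half-spin representation of `D₅` pair up to the ten weights of the
vector representation: `pairWt v` is the common value of `xiRoot i + xiRoot (partner v i)`, for
the indices `i` of the variables that occur in the quadric `zeta (v + 1)`. -/
def pairWt : Fin 10 → Lattice :=
  ![![0, 1, 1, 2, 2, 2], ![1, 1, 1, 2, 2, 2], ![1, 1, 2, 2, 2, 2], ![1, 1, 2, 3, 2, 2],
    ![1, 1, 2, 3, 3, 2], ![2, 2, 3, 4, 3, 2], ![1, 2, 3, 4, 3, 2], ![1, 2, 2, 4, 3, 2],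
    ![1, 2, 2, 3, 3, 2], ![1, 2, 2, 3, 2, 2]]

/-- The coefficient in the quadric `zeta (v + 1)` of the monomial that contains `X i`. -/
def pairSgn : Fin 10 → Fin 16 → ℤ :=
  ![![1, 1, -1, 1, 1, -1, 0, 0, 1, 0, 1, 0, 0, 0, 0, 0],
    ![1, 1, -1, 0, 1, 0, 1, -1, 0, 1, 0, 0, 1, 0, 0, 0],
    ![1, 1, 0, -1, 0, 1, 1, -1, 0, 0, 0, 1, 0, 1, 0, 0],
    ![1, 0, -1, 1, 0, 0, -1, 0, -1, 1, 0, -1, 0, 0, 1, 0],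
    ![0, -1, -1, 1, 0, 0, -1, 0, 0, 0, -1, 0, 1, -1, -1, 0],
    ![0, 0, 0, 0, 0, 0, 1, 1, 0, 1, 0, -1, -1, 1, 1, 1],
    ![0, 0, 0, -1, 0, -1, 0, 0, -1, 0, 1, 1, 0, -1, -1, -1],
    ![0, 0, 1, 0, 1, 0, 0, 0, 1, -1, -1, 0, 1, 0, 1, 1],
    ![0, 1, 0, 0, -1, 1, 0, -1, 0, 0, -1, 0, 1, -1, 0, 1],
    ![1, 0, 0, 0, 1, -1, 0, 1, 1, -1, 0, 1, 0, 0, 0, 1]]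

/-- The index of the variable by which `X i` is multiplied in the quadric `zeta (v + 1)`
(and `0` if `X i` does not occur there). -/
def partner : Fin 10 → Fin 16 → Fin 16 :=
  ![![10, 8, 5, 4, 3, 2, 0, 0, 1, 0, 0, 0, 0, 0, 0, 0],
    ![12, 9, 7, 0, 6, 0, 4, 2, 0, 1, 0, 0, 0, 0, 0, 0],
    ![13, 11, 0, 7, 0, 6, 5, 3, 0, 0, 0, 1, 0, 0, 0, 0],
    ![14, 0, 11, 9, 0, 0, 8, 0, 6, 3, 0, 2, 0, 0, 0, 0],
    ![0, 14, 13, 12, 0, 0, 10, 0, 0, 0, 6, 0, 3, 2, 1, 0],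
    ![0, 0, 0, 0, 0, 0, 15, 14, 0, 13, 0, 12, 11, 9, 7, 6],
    ![0, 0, 0, 15, 0, 14, 0, 0, 13, 0, 11, 10, 0, 8, 5, 3],
    ![0, 0, 15, 0, 14, 0, 0, 0, 12, 10, 9, 0, 8, 0, 4, 2],
    ![0, 15, 0, 0, 13, 12, 0, 10, 0, 0, 7, 0, 5, 4, 0, 1],
    ![15, 0, 0, 0, 11, 9, 0, 8, 7, 5, 0, 4, 0, 0, 0, 0]]

/-- The sign by which the signs in `zeta (v + 1)` differ from those given by `sgnF`. -/
def zetaSgn : Fin 10 → ℤ := ![-1, -1, -1, -1, -1, -1, -1, -1, 1, -1]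

/-- A negative product would make the sum of the two roots zero or a root, although its coefficient
of `α₆` is 2; the value 2 would force the roots to coincide. -/
theorem form_xiRoot : ∀ i j : Fin 16, (i = j → form (xiRoot i) (xiRoot j) = 2) ∧
    (i ≠ j → form (xiRoot i) (xiRoot j) = 0 ∨ form (xiRoot i) (xiRoot j) = 1) := by
  decide +kernel

theorem xiRoot_five : ∀ i, xiRoot i 5 = 1 := by decide

theorem xiRoot_add_partner : ∀ v i, pairSgn v i ≠ 0 →
    ∀ k, xiRoot i k + xiRoot (partner v i) k = pairWt v k := by
  decide +kernel

theorem pairSgn_ne_zero_iff : ∀ v i, pairSgn v i ≠ 0 ↔ form (xiRoot i) (pairWt v) = 2 := by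
  decide +kernel

theorem pairSgn_sq : ∀ v i, pairSgn v i ≠ 0 → pairSgn v i * pairSgn v i = 1 := by
  decide +kernel

theorem zetaSgn_sq : ∀ v, zetaSgn v * zetaSgn v = 1 := by
  decide +kernel

theorem partner_partner : ∀ v i, pairSgn v i ≠ 0 → partner v (partner v i) = i ∧
    pairSgn v (partner v i) = pairSgn v i := by
  decide +kernel

/-- The signs of a quadric are those of the cocycle `F` up to one global sign. That sign is
harmless, since only products of two signs from the same quadric enter the triple products and the
derivatives of the `P_i`. -/
theorem even_signExp_iff : ∀ v i, pairSgn v i ≠ 0 →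
    (signExp (xiRoot i) (xiRoot (partner v i)) % 2 = 0 ↔ zetaSgn v * pairSgn v i = 1) := by
  decide +kernel

theorem exists_partner : ∀ i j, form (xiRoot i) (xiRoot j) = 0 →
    ∃ v, pairSgn v i ≠ 0 ∧ partner v i = j := by
  decide +kernel

theorem pairWt_injective : Function.Injective pairWt := by
  decide +kernel

-- A finite search for the roots with `α₆`-coefficient 1: the equation is `six_form` with right side
-- `6 · 2 = 12`, and the variables are shifted into `Fin` types. The partial inequalities stand
-- between the quantifiers in order to prune the search early.
set_option synthInstance.maxSize 1000 in
set_option synthInstance.maxHeartbeats 200000 in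
theorem exists_xiRoot_of_box : ∀ p₄ : Fin 5, ∀ p₃ : Fin 7,
    3 * (2 - (p₄ : ℤ)) ^ 2 + (3 * (p₄ : ℤ) - 2 * ((p₃ : ℤ) - 3)) ^ 2 + ((p₃ : ℤ) - 3) ^ 2 ≤ 12 →
    ∀ p₂ : Fin 7, (3 * ((p₂ : ℤ) - 3) - 2 * ((p₃ : ℤ) - 3)) ^ 2 ≤ 12 → ∀ p₁ p₀ : Fin 5,
    3 * (2 * ((p₀ : ℤ) - 2) - ((p₂ : ℤ) - 3)) ^ 2 + 3 * (2 * ((p₁ : ℤ) - 2) - ((p₃ : ℤ) - 3)) ^ 2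
      + 3 * (2 - (p₄ : ℤ)) ^ 2 + (3 * ((p₂ : ℤ) - 3) - 2 * ((p₃ : ℤ) - 3)) ^ 2
      + (3 * (p₄ : ℤ) - 2 * ((p₃ : ℤ) - 3)) ^ 2 + ((p₃ : ℤ) - 3) ^ 2 = 12 →
    ∃ i, xiRoot i 0 = (p₀ : ℤ) - 2 ∧ xiRoot i 1 = (p₁ : ℤ) - 2 ∧ xiRoot i 2 = (p₂ : ℤ) - 3 ∧
      xiRoot i 3 = (p₃ : ℤ) - 3 ∧ xiRoot i 4 = (p₄ : ℤ) := by
  decide +kernel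

theorem exists_fin_cast_eq (n : ℕ) (z : ℤ) (h0 : 0 ≤ z) (h1 : z < n) :
    ∃ p : Fin n, (p : ℤ) = z :=
  ⟨⟨z.toNat, by omega⟩, by simp [h0]⟩

theorem exists_xiRoot (a : Lattice) (ha : form a a = 2) (h5 : a 5 = 1) : ∃ i, xiRoot i = a := by
  have h6 := six_form a
  rw [ha, h5] at h6
  have s0 := sq_nonneg (2 * a 0 - a 2)
  have s1 := sq_nonneg (2 * a 1 - a 3)
  have s5 := sq_nonneg (2 * 1 - a 4)
  have s2 := sq_nonneg (3 * a 2 - 2 * a 3)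
  have s4 := sq_nonneg (3 * a 4 - 2 * a 3)
  have s3 := sq_nonneg (a 3)
  obtain ⟨b3, b3'⟩ := abs_lt_of_sq_lt_sq' (show a 3 ^ 2 < 4 ^ 2 by linarith) (by norm_num)
  obtain ⟨b0, b0'⟩ := abs_lt_of_sq_lt_sq' (show (2 * a 0 - a 2) ^ 2 < 3 ^ 2 by linarith)
    (by norm_num)
  obtain ⟨b1, b1'⟩ := abs_lt_of_sq_lt_sq' (show (2 * a 1 - a 3) ^ 2 < 3 ^ 2 by linarith)
    (by norm_num)
  obtain ⟨b5, b5'⟩ := abs_lt_of_sq_lt_sq' (show (2 * 1 - a 4) ^ 2 < 3 ^ 2 by linarith)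
    (by norm_num)
  obtain ⟨b2, b2'⟩ := abs_lt_of_sq_lt_sq' (show (3 * a 2 - 2 * a 3) ^ 2 < 4 ^ 2 by linarith)
    (by norm_num)
  obtain ⟨p4, e4⟩ := exists_fin_cast_eq 5 (a 4) (by omega) (by omega)
  obtain ⟨p3, e3⟩ := exists_fin_cast_eq 7 (a 3 + 3) (by omega) (by omega)
  obtain ⟨p2, e2⟩ := exists_fin_cast_eq 7 (a 2 + 3) (by omega) (by omega)
  obtain ⟨p1, e1⟩ := exists_fin_cast_eq 5 (a 1 + 2) (by omega) (by omega)
  obtain ⟨p0, e0⟩ := exists_fin_cast_eq 5 (a 0 + 2) (by omega) (by omega)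
  have key := exists_xiRoot_of_box p4 p3
  simp only [e4, e3, add_sub_cancel_right] at key
  have key := key (by linarith) p2
  simp only [e2, add_sub_cancel_right] at key
  have key := key (by linarith) p1 p0
  simp only [e1, e0, add_sub_cancel_right] at key
  obtain ⟨i, h0, h1, h2, h3, h4⟩ := key (by linarith)
  refine ⟨i, funext fun k => ?_⟩
  fin_cases k
  exacts [h0, h1, h2, h3, h4, (xiRoot_five i).trans h5.symm]

theorem root_five (a : Lattice) (ha : form a a = 2) : a 5 = -1 ∨ a 5 = 0 ∨ a 5 = 1 := by
  -- This vector is four times the projection of `a` to the orthogonal complement of `α̂`. Its norm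
  -- is `32 - 12 (a 5)²`, so nonnegativity leaves only `|a 5| ≤ 1`.
  have h := form_nonneg ((4 : ℤ) • a + (-(a 5)) • ![2, 3, 4, 6, 5, 4])
  have e : form ((4 : ℤ) • a + (-(a 5)) • ![2, 3, 4, 6, 5, 4])
      ((4 : ℤ) • a + (-(a 5)) • ![2, 3, 4, 6, 5, 4]) = 16 * form a a - 12 * a 5 ^ 2 := by
    simp only [form, Pi.add_apply, Pi.smul_apply, smul_eq_mul, Matrix.cons_val]
    ring
  rw [e, ha] at h
  obtain ⟨b, b'⟩ := abs_lt_of_sq_lt_sq' (show a 5 ^ 2 < 2 ^ 2 by linarith) (by norm_num)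
  omega

theorem xiRoot_self (i : Fin 16) : form (xiRoot i) (xiRoot i) = 2 := (form_xiRoot i i).1 rfl

theorem neg_xiRoot_self (i : Fin 16) : form (-xiRoot i) (-xiRoot i) = 2 := by
  rw [form_neg_left, form_neg_right, neg_neg, xiRoot_self]

theorem xiRoot_injective : Function.Injective xiRoot := by
  intro i j h
  by_contra hij
  have h1 := (form_xiRoot i j).2 hij
  rw [h, xiRoot_self] at h1
  omega

/-! ### The grading -/

theorem lie_H_E (h : Fin 6 → ℂ) (a : Lattice) : ⁅ofH h, E a⁆ = form h (toC a) • E a := HE h a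

theorem lie_E_E (a b : Lattice) (ha : form a a = 2) (hb : form b b = 2) :
    ⁅E a, E b⁆ = rootBracket a b := EE a b ha hb

theorem form_alphaHat (a : Lattice) : form alphaHat (toC a) = 3 * (a 5 : ℂ) := by
  simp only [form, alphaHat, toC, Matrix.cons_val]
  ring

/-- The component of degree `k` of `G`, in which `E_a` has degree the coefficient of `α₆` in `a`:
an eigenspace of `α̂`. -/
def grade (k : ℤ) : Submodule ℂ G where
  carrier := {y | ⁅ofH alphaHat, y⁆ = (3 * (k : ℂ)) • y}
  zero_mem' := by simp
  add_mem' := by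
    intro a b ha hb
    simp only [Set.mem_ofPred_eq] at *
    rw [lie_add, ha, hb, smul_add]
  smul_mem' := by
    intro r a ha
    simp only [Set.mem_ofPred_eq] at *
    rw [lie_smul, ha, smul_comm]

theorem mem_grade {k : ℤ} {y : G} : y ∈ grade k ↔ ⁅ofH alphaHat, y⁆ = (3 * (k : ℂ)) • y := Iff.rfl

theorem lie_mem_grade {k l m : ℤ} (hm : k + l = m) {y z : G} (hy : y ∈ grade k)
    (hz : z ∈ grade l) : ⁅y, z⁆ ∈ grade m := by
  rw [mem_grade] at *
  rw [leibniz_lie, hy, hz, smul_lie, lie_smul, ← add_smul, ← hm]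
  push_cast
  congr 1
  ring

theorem E_mem_grade {k : ℤ} (a : Lattice) (h : a 5 = k) : E a ∈ grade k := by
  rw [mem_grade, lie_H_E, form_alphaHat, h]

theorem xi_mem_grade (i : Fin 16) : xi i ∈ grade 1 := E_mem_grade _ (xiRoot_five i)

theorem eta_mem_grade (i : Fin 16) : eta i ∈ grade (-1) :=
  E_mem_grade _ (by simp [xiRoot_five i])

theorem rPart_E (a : Lattice) (ha : form a a = 2) : rPart (E a) = Finsupp.single ⟨a, ha⟩ 1 := by
  rw [E_of_root a ha, rPart_ofR]

theorem rPart_lie_ofH (h : Fin 6 → ℂ) (y : G) (a : Root) :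
    rPart ⁅ofH h, y⁆ a = form h (toC a.1) * rPart y a := by
  induction y using G_induction with
  | hH k =>
    rw [← bracketL_apply, HH]
    simp
  | hE b hb =>
    rw [lie_H_E, map_smul, rPart_E b hb, Finsupp.smul_apply, smul_eq_mul, Finsupp.single_apply]
    split_ifs with h1
    · rw [← h1]
    · simp
  | hadd x y hx hy => rw [lie_add, map_add, map_add, Finsupp.add_apply, Finsupp.add_apply, hx, hy,
      mul_add]
  | hsmul r x hx =>
    rw [lie_smul, map_smul, map_smul, Finsupp.smul_apply, Finsupp.smul_apply, hx]
    simp only [smul_eq_mul]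
    ring

theorem hPart_lie_ofH (h : Fin 6 → ℂ) (y : G) : hPart ⁅ofH h, y⁆ = 0 := by
  induction y using G_induction with
  | hH k =>
    rw [← bracketL_apply, HH]
    simp
  | hE b hb => simp [lie_H_E]
  | hadd x y hx hy => rw [lie_add, map_add, hx, hy, add_zero]
  | hsmul r x hx => rw [lie_smul, map_smul, hx, smul_zero]

theorem rPart_eq_zero {k : ℤ} {y : G} (hy : y ∈ grade k) (a : Root) (ha : a.1 5 ≠ k) :
    rPart y a = 0 := by
  have h := rPart_lie_ofH alphaHat y a
  rw [mem_grade.1 hy, map_smul, Finsupp.smul_apply, smul_eq_mul, form_alphaHat] at h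
  have h1 : (3 * ((k : ℂ) - (a.1 5 : ℂ))) * rPart y a = 0 := by linear_combination h
  refine (mul_eq_zero.1 h1).resolve_left ?_
  refine mul_ne_zero (by norm_num) (sub_ne_zero.2 ?_)
  exact_mod_cast ha.symm

theorem hPart_eq_zero {k : ℤ} {y : G} (hy : y ∈ grade k) (hk : k ≠ 0) : hPart y = 0 := by
  have h := hPart_lie_ofH alphaHat y
  rw [mem_grade.1 hy, map_smul] at h
  refine (smul_eq_zero.1 h).resolve_left ?_
  exact mul_ne_zero (by norm_num) (by exact_mod_cast hk)

theorem coeffE_of_root (a : Lattice) (ha : form a a = 2) (y : G) : coeffE a y = rPart y ⟨a, ha⟩ :=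
  dif_pos ha

/-- `coeffE` as a linear functional. -/
def coeffL (v : Lattice) : G →ₗ[ℂ] ℂ where
  toFun := coeffE v
  map_add' x y := by unfold coeffE; split_ifs <;> simp
  map_smul' r x := by unfold coeffE; split_ifs <;> simp

theorem coeffL_apply (v : Lattice) (y : G) : coeffL v y = coeffE v y := rfl

theorem coeffE_E (v a : Lattice) (ha : form a a = 2) : coeffE v (E a) = if a = v then 1 else 0 := by
  unfold coeffE
  split_ifs with h1 h2 h2
  · subst h2
    simp [rPart_E a ha]
  · rw [rPart_E a ha, Finsupp.single_apply, if_neg]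
    simpa using h2
  · exact absurd (h2 ▸ ha) h1
  · rfl

theorem coeffE_ofH (v : Lattice) (h : Fin 6 → ℂ) : coeffE v (ofH h) = 0 := by
  unfold coeffE
  split_ifs <;> simp

theorem coeffE_grade {k : ℤ} {y : G} (hy : y ∈ grade k) (v : Lattice) (hv : v 5 ≠ k) :
    coeffE v y = 0 := by
  unfold coeffE
  split_ifs with h
  · exact rPart_eq_zero hy _ hv
  · rfl

theorem G_ext {x y : G} (hH : hPart x = hPart y) (hR : ∀ a, rPart x a = rPart y a) : x = y := by
  rw [← ofH_add_ofR x, ← ofH_add_ofR y, hH, Finsupp.ext hR]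

theorem rPart_sum_coeffE (y : G) (s : ℤ) (hs : s = 1 ∨ s = -1) (a : Root) :
    rPart (∑ i, coeffE (s • xiRoot i) y • E (s • xiRoot i)) a =
      if a.1 5 = s then rPart y a else 0 := by
  have hss : s * s = 1 := by rcases hs with rfl | rfl <;> rfl
  have hroot : ∀ i, form (s • xiRoot i) (s • xiRoot i) = 2 := fun i => by
    rw [form_smul_left, form_comm, form_smul_left, xiRoot_self, ← mul_assoc, hss, one_mul]
  have h5 : ∀ i, (s • xiRoot i) 5 = s := fun i => by simp [xiRoot_five]
  simp only [map_sum, map_smul, Finsupp.coe_finsetSum, Finset.sum_apply, Finsupp.smul_apply,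
    rPart_E _ (hroot _), Finsupp.single_apply, smul_eq_mul, mul_ite, mul_one, mul_zero]
  split_ifs with ha
  · obtain ⟨j, hj⟩ := exists_xiRoot (s • a.1)
      (by rw [form_smul_left, form_comm, form_smul_left, a.2, ← mul_assoc, hss, one_mul])
      (by simp [ha, hss])
    have hj' : s • xiRoot j = a.1 := by rw [hj, smul_smul, hss, one_smul]
    rw [Finset.sum_eq_single j]
    · rw [if_pos (Subtype.ext hj'), coeffE_of_root _ (hroot j)]
      congr 1
      exact Subtype.ext hj'
    · intro i _ hij
      rw [if_neg]
      intro h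
      have h' : s • xiRoot i = s • xiRoot j := by rw [hj', ← h]
      refine hij (xiRoot_injective ?_)
      rw [← one_smul ℤ (xiRoot i), ← one_smul ℤ (xiRoot j), ← hss, mul_smul, h', mul_smul]
    · simp
  · refine Finset.sum_eq_zero fun i _ => if_neg fun h => ha ?_
    rw [← h]
    exact h5 i

theorem rPart_sum_xi (y : G) (a : Root) :
    rPart (∑ i, coeffE (xiRoot i) y • xi i) a = if a.1 5 = 1 then rPart y a else 0 := by
  simpa [xi] using rPart_sum_coeffE y 1 (Or.inl rfl) a

theorem rPart_sum_eta (y : G) (a : Root) :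
    rPart (∑ i, coeffE (-xiRoot i) y • eta i) a = if a.1 5 = -1 then rPart y a else 0 := by
  simpa [eta] using rPart_sum_coeffE y (-1) (Or.inr rfl) a

theorem hPart_sum_xi (y : G) : hPart (∑ i, coeffE (xiRoot i) y • xi i) = 0 := by
  simp [xi]

theorem hPart_sum_eta (y : G) : hPart (∑ i, coeffE (-xiRoot i) y • eta i) = 0 := by
  simp [eta]

theorem hPart_zeroPart (y : G) : hPart (zeroPart y) = hPart y := by
  simp [zeroPart]

theorem rPart_zeroPart (y : G) (a : Root) :
    rPart (zeroPart y) a = if a.1 5 = 0 then rPart y a else 0 := by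
  simp [zeroPart, Finsupp.filter_apply]

theorem decomposition (y : G) : zeroPart y + ∑ i, coeffE (xiRoot i) y • xi i
    + ∑ i, coeffE (-xiRoot i) y • eta i = y := by
  refine G_ext ?_ fun a => ?_
  · rw [map_add, map_add, hPart_sum_xi, hPart_sum_eta, hPart_zeroPart, add_zero, add_zero]
  · rw [map_add, map_add, Finsupp.add_apply, Finsupp.add_apply, rPart_sum_xi, rPart_sum_eta,
      rPart_zeroPart]
    rcases root_five a.1 a.2 with h | h | h <;> simp [h]

theorem zeroPart_eq_self {y : G} (hy : y ∈ grade 0) : zeroPart y = y := by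
  refine G_ext (hPart_zeroPart y) fun a => ?_
  rw [rPart_zeroPart]
  split_ifs with h
  · rfl
  · exact (rPart_eq_zero hy a h).symm

theorem zeroPart_eq_zero {k : ℤ} {y : G} (hy : y ∈ grade k) (hk : k ≠ 0) : zeroPart y = 0 := by
  refine G_ext ?_ fun a => ?_
  · rw [hPart_zeroPart, hPart_eq_zero hy hk, map_zero]
  · rw [rPart_zeroPart, map_zero, Finsupp.zero_apply]
    split_ifs with h
    · exact rPart_eq_zero hy a (h ▸ hk.symm)
    · rfl

theorem zeroPart_mem_grade (y : G) : zeroPart y ∈ grade 0 := by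
  rw [mem_grade]
  refine G_ext ?_ fun a => ?_
  · simp [hPart_lie_ofH]
  · rw [rPart_lie_ofH, form_alphaHat, rPart_zeroPart]
    split_ifs with h <;> simp [h]

theorem eq_sum_xi {y : G} (hy : y ∈ grade 1) : y = ∑ i, coeffE (xiRoot i) y • xi i := by
  have h := decomposition y
  rw [zeroPart_eq_zero hy one_ne_zero, zero_add, Finset.sum_eq_zero (s := Finset.univ)
    (f := fun i => coeffE (-xiRoot i) y • eta i), add_zero] at h
  · exact h.symm
  · intro i _
    rw [coeffE_grade hy _ (by simp [xiRoot_five]), zero_smul]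

theorem eq_sum_eta {y : G} (hy : y ∈ grade (-1)) : y = ∑ i, coeffE (-xiRoot i) y • eta i := by
  have h := decomposition y
  rw [zeroPart_eq_zero hy (by norm_num), zero_add, Finset.sum_eq_zero (s := Finset.univ)
    (f := fun i => coeffE (xiRoot i) y • xi i), zero_add] at h
  · exact h.symm
  · intro i _
    rw [coeffE_grade hy _ (by simp [xiRoot_five]), zero_smul]

theorem eq_zero_of_mem_grade {k : ℤ} {y : G} (hy : y ∈ grade k) (hk : 1 < |k|) : y = 0 := by
  have hk0 : k ≠ 0 := by rintro rfl; simp at hk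
  have hk1 : k ≠ 1 := by rintro rfl; simp at hk
  have hk2 : k ≠ -1 := by rintro rfl; simp at hk
  refine G_ext ?_ fun a => ?_
  · rw [hPart_eq_zero hy hk0, map_zero]
  · rw [map_zero, Finsupp.zero_apply]
    refine rPart_eq_zero hy a ?_
    rcases root_five a.1 a.2 with h | h | h <;> omega

theorem graded_induction {p : G → Prop} (h0 : ∀ u ∈ grade 0, p u) (h1 : ∀ i, p (xi i))
    (h2 : ∀ i, p (eta i)) (hadd : ∀ x y, p x → p y → p (x + y))
    (hsmul : ∀ (r : ℂ) x, p x → p (r • x)) (x : G) : p x := by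
  have hsum : ∀ f : Fin 16 → G, (∀ i, p (f i)) → p (∑ i, f i) := fun f hf =>
    Finset.sum_induction f p hadd (h0 0 (Submodule.zero_mem _)) fun i _ => hf i
  rw [← decomposition x]
  exact hadd _ _ (hadd _ _ (h0 _ (zeroPart_mem_grade x)) (hsum _ fun i => hsmul _ _ (h1 i)))
    (hsum _ fun i => hsmul _ _ (h2 i))

/-! ### Structure constants -/

theorem coeffE_rootBracket (v a b : Lattice) (hv : form v v = 2) :
    coeffE v (rootBracket a b) = if a + b = v then sgnF a b else 0 := by
  have hv0 : v ≠ 0 := by rintro rfl; simp [form] at hv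
  unfold rootBracket
  split_ifs with h1 h2 h2
  · exact absurd (h2.symm.trans h1) hv0
  · rw [← map_neg, coeffE_ofH]
  · rw [← coeffL_apply, map_smul, coeffL_apply, h2, coeffE_E v v hv]
    simp
  · by_cases hab : form (a + b) (a + b) = 2
    · rw [← coeffL_apply, map_smul, coeffL_apply, coeffE_E v _ hab, if_neg h2, smul_zero]
    · rw [E_of_not_root _ hab, smul_zero, ← coeffL_apply, map_zero]

/-- The coefficients of the actions on `G₁` and `G₋₁` are dual to each other. -/
theorem coeffE_lie_xi (u : G) (i r : Fin 16) :
    coeffE (xiRoot i) ⁅u, xi r⁆ = -coeffE (-xiRoot r) ⁅u, eta i⁆ := by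
  simp only [← coeffL_apply]
  induction u using G_induction with
  | hH h =>
    rw [xi, eta, lie_H_E, lie_H_E, map_smul, map_smul, coeffL_apply, coeffL_apply,
      coeffE_E _ _ (xiRoot_self r), coeffE_E _ _ (neg_xiRoot_self i), toC_neg, form_neg_right]
    by_cases hir : i = r
    · simp [hir]
    · rw [if_neg fun h => hir (xiRoot_injective h).symm,
        if_neg fun h => hir (xiRoot_injective (neg_injective h))]
      simp
  | hE a ha =>
    rw [xi, eta, lie_E_E _ _ ha (xiRoot_self r), lie_E_E _ _ ha (neg_xiRoot_self i), coeffL_apply,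
      coeffL_apply, coeffE_rootBracket _ _ _ (xiRoot_self i),
      coeffE_rootBracket _ _ _ (neg_xiRoot_self r)]
    by_cases h : a + xiRoot r = xiRoot i
    · rw [if_pos h, if_pos (by rw [← h]; abel), sgnF_neg_right, ← h, sgnF_add_right,
        sgnF_self a ha]
      ring
    · rw [if_neg h, if_neg, neg_zero]
      intro h'
      apply h
      have : a = xiRoot i - xiRoot r := by rw [sub_eq_neg_add, ← h']; abel
      rw [this]
      abel
  | hadd x y hx hy => rw [add_lie, add_lie, map_add, map_add, hx, hy]; ring
  | hsmul r x hx => rw [smul_lie, smul_lie, map_smul, map_smul, hx, smul_neg]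

theorem sgnF_partner (v : Fin 10) (i : Fin 16) (h : pairSgn v i ≠ 0) :
    sgnF (xiRoot i) (xiRoot (partner v i)) = ((zetaSgn v * pairSgn v i : ℤ) : ℂ) := by
  have h1 := even_signExp_iff v i h
  have h2 : zetaSgn v * pairSgn v i = 1 ∨ zetaSgn v * pairSgn v i = -1 := by
    refine mul_self_eq_one_iff.1 ?_
    rw [mul_mul_mul_comm, zetaSgn_sq, pairSgn_sq v i h, one_mul]
  unfold sgnF
  rcases h2 with h2 | h2
  · rw [Int.negOnePow_even _ (Int.even_iff.2 (h1.2 h2)), h2]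
    simp
  · rw [Int.negOnePow_odd _ (Int.odd_iff.2 ?_), h2]
    · simp
    · have : ¬ signExp (xiRoot i) (xiRoot (partner v i)) % 2 = 0 := fun h => by
        rw [h1] at h; omega
      omega

theorem xiRoot_add_partner' {v : Fin 10} {i : Fin 16} (h : pairSgn v i ≠ 0) :
    xiRoot i + xiRoot (partner v i) = pairWt v := funext (xiRoot_add_partner v i h)

theorem form_partner {v : Fin 10} {i : Fin 16} (h : pairSgn v i ≠ 0) :
    form (xiRoot i) (xiRoot (partner v i)) = 0 := by
  have h1 := (pairSgn_ne_zero_iff v i).1 h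
  rw [← xiRoot_add_partner' h, form_add_right, xiRoot_self] at h1
  omega

theorem lie_xi_eta_self (i : Fin 16) : ⁅xi i, eta i⁆ = -ofH (toC (xiRoot i)) := by
  rw [xi, eta, lie_E_E _ _ (xiRoot_self i) (neg_xiRoot_self i), rb_neg _ _ (xiRoot_self i)
    (neg_xiRoot_self i) (by rw [form_neg_right, xiRoot_self])]

theorem lie_xi_eta_of_form_eq_zero {r i : Fin 16} (h : form (xiRoot r) (xiRoot i) = 0) :
    ⁅xi r, eta i⁆ = 0 := by
  rw [xi, eta, lie_E_E _ _ (xiRoot_self r) (neg_xiRoot_self i), rb_zero _ _ (xiRoot_self r)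
    (neg_xiRoot_self i) (by rw [form_neg_right, h, neg_zero])]

theorem lie_xi_eta_of_form_eq_one {r i : Fin 16} (h : form (xiRoot r) (xiRoot i) = 1) :
    ⁅xi r, eta i⁆ = sgnF (xiRoot r) (xiRoot i) • E (xiRoot r + -xiRoot i) := by
  rw [xi, eta, lie_E_E _ _ (xiRoot_self r) (neg_xiRoot_self i), rb_one _ _ (xiRoot_self r)
    (neg_xiRoot_self i) (by rw [form_neg_right, h]), sgnF_neg_right]

theorem lie_lie_eta_self (i j : Fin 16) :
    ⁅⁅xi i, eta i⁆, eta j⁆ = ((form (xiRoot i) (xiRoot j) : ℤ) : ℂ) • eta j := by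
  rw [lie_xi_eta_self, neg_lie, eta, lie_H_E, toC_neg, form_neg_right, form_toC, neg_smul, neg_neg]

theorem lie_lie_eta_of_form_eq_one {r i j : Fin 16} (h : form (xiRoot r) (xiRoot i) = 1) :
    ⁅⁅xi r, eta i⁆, eta j⁆ = if form (xiRoot r) (xiRoot j) = form (xiRoot i) (xiRoot j) + 1 then
      (sgnF (xiRoot r) (xiRoot i) * (sgnF (xiRoot r) (xiRoot j) * sgnF (xiRoot i) (xiRoot j))) •
        E (xiRoot r + -xiRoot i + -xiRoot j) else 0 := by
  have hroot : form (xiRoot r + -xiRoot i) (xiRoot r + -xiRoot i) = 2 := by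
    rw [form_add_self _ _ (xiRoot_self r) (neg_xiRoot_self i), form_neg_right, h]
    norm_num
  have hform : form (xiRoot r + -xiRoot i) (-xiRoot j) =
      form (xiRoot i) (xiRoot j) - form (xiRoot r) (xiRoot j) := by
    rw [form_neg_right, form_add_left, form_neg_left]
    ring
  rw [lie_xi_eta_of_form_eq_one h, smul_lie, eta, lie_E_E _ _ hroot (neg_xiRoot_self j)]
  split_ifs with h1
  · rw [rb_one _ _ hroot (neg_xiRoot_self j) (by rw [hform, h1]; ring), smul_smul, sgnF_neg_right,
      sgnF_add_left, sgnF_neg_left]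
  · rw [rb_zero _ _ hroot (neg_xiRoot_self j), smul_zero]
    rw [hform]
    -- The product of `β_r - β_i` with `-β_j` is `(β_i, β_j) - (β_r, β_j)`. It is at least `-1` in
    -- every case, and `h1` excludes `-1`.
    by_cases hrj : r = j
    · subst hrj
      rw [xiRoot_self, form_comm, h] at h1
      omega
    · have h2 := (form_xiRoot r j).2 hrj
      by_cases hij : i = j
      · subst hij
        rw [xiRoot_self, h]
        omega
      · have h3 := (form_xiRoot i j).2 hij
        omega

/-- A pair of partners lies in only one quadric: its sum of roots is `pairWt`, which is injective.
Hence the sum over quadrics in `lie_lie_eta` has at most one nonzero term. -/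
theorem sum_partner_eq {v : Fin 10} {i : Fin 16} (h : pairSgn v i ≠ 0) (r : Fin 16) {N : Type*}
    [AddCommGroup N] [Module ℂ N] (f : Fin 16 → N) :
    (∑ w, if partner w i = partner v i then
      ((pairSgn w i * pairSgn w r : ℤ) : ℂ) • f (partner w r) else 0) =
      ((pairSgn v i * pairSgn v r : ℤ) : ℂ) • f (partner v r) := by
  rw [Finset.sum_eq_single v, if_pos rfl]
  · intro w _ hw
    split_ifs with h1
    · by_cases h2 : pairSgn w i = 0
      · simp [h2]
      · refine absurd (pairWt_injective ?_) hw
        rw [← xiRoot_add_partner' h2, ← xiRoot_add_partner' h, h1]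
    · rfl
  · simp

theorem sum_partner_eq_zero {i j : Fin 16} (h : form (xiRoot i) (xiRoot j) ≠ 0) (r : Fin 16)
    {N : Type*} [AddCommGroup N] [Module ℂ N] (f : Fin 16 → N) :
    (∑ w, if partner w i = j then
      ((pairSgn w i * pairSgn w r : ℤ) : ℂ) • f (partner w r) else 0) = 0 := by
  refine Finset.sum_eq_zero fun w _ => ?_
  split_ifs with h1
  · by_cases h2 : pairSgn w i = 0
    · simp [h2]
    · exact absurd (h1 ▸ form_partner h2) h
  · rfl

/-- The triple products `[[ξ_r, η_i], η_j]`. -/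
theorem lie_lie_eta (r i j : Fin 16) :
    ⁅⁅xi r, eta i⁆, eta j⁆ = (if i = r then eta j else 0) + (if j = r then eta i else 0)
      - ∑ v, if partner v i = j then
          ((pairSgn v i * pairSgn v r : ℤ) : ℂ) • eta (partner v r) else 0 := by
  -- If `β_i` and `β_j` are orthogonal they are partners in a single quadric, which supplies the
  -- last sum. Otherwise that sum vanishes and only the Kronecker terms remain.
  by_cases hij : form (xiRoot i) (xiRoot j) = 0
  · obtain ⟨v, hv, rfl⟩ := exists_partner i j hij
    rw [sum_partner_eq hv]
    obtain ⟨hpp, hps⟩ := partner_partner v i hv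
    have hne : partner v i ≠ i := fun h => by
      rw [h, xiRoot_self] at hij; omega
    by_cases hri : i = r
    · subst hri
      rw [lie_lie_eta_self, hij, if_pos rfl, if_neg hne, pairSgn_sq v i hv]
      simp
    rw [if_neg hri]
    by_cases hrj : partner v i = r
    · rw [if_pos hrj, lie_xi_eta_of_form_eq_zero (by rw [← hrj, form_comm, hij]), zero_lie, ← hrj,
        hpp, hps, pairSgn_sq v i hv]
      simp
    rw [if_neg hrj, zero_add, zero_sub]
    have h1 := (form_xiRoot r i).2 (Ne.symm hri)
    have h2 := (form_xiRoot r (partner v i)).2 (Ne.symm hrj)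
    have h3 : pairSgn v r ≠ 0 ↔
        form (xiRoot r) (xiRoot i) + form (xiRoot r) (xiRoot (partner v i)) = 2 := by
      rw [pairSgn_ne_zero_iff, ← xiRoot_add_partner' hv, form_add_right]
    rcases h1 with h1 | h1
    · have h4 : pairSgn v r = 0 := by
        by_contra h
        have := h3.1 h
        omega
      rw [lie_xi_eta_of_form_eq_zero h1, zero_lie, h4]
      simp
    · rw [lie_lie_eta_of_form_eq_one h1, hij]
      rcases h2 with h2 | h2
      · have h4 : pairSgn v r = 0 := by
          by_contra h
          have := h3.1 h
          omega
        rw [if_neg (by omega), h4]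
        simp
      · have h4 : pairSgn v r ≠ 0 := h3.2 (by omega)
        -- Both pairs have the same sum, so `β_{partner r}` is an integral combination of `β_r`,
        -- `β_i` and `β_{partner i}`. Bimultiplicativity of `F` then turns the sign of the pair of
        -- `r` into the structure constant sought; `zetaSgn v` enters twice and cancels.
        have h5 : xiRoot (partner v r) = -xiRoot r + (xiRoot i + xiRoot (partner v i)) := by
          rw [xiRoot_add_partner' hv, ← xiRoot_add_partner' h4]
          abel
        have h6 : xiRoot r + -xiRoot i + -xiRoot (partner v i) = -xiRoot (partner v r) := by
          rw [h5]
          abel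
        have h7 := sgnF_partner v r h4
        rw [h5, sgnF_add_right, sgnF_add_right, sgnF_neg_right, sgnF_self _ (xiRoot_self r)] at h7
        have h8 := sgnF_partner v i hv
        have h9 : ((zetaSgn v : ℤ) : ℂ) * ((zetaSgn v : ℤ) : ℂ) = 1 := by
          exact_mod_cast zetaSgn_sq v
        rw [if_pos (by omega), h6, ← eta, ← neg_smul]
        congr 1
        push_cast at h7 h8 ⊢
        rw [h8]
        linear_combination (-(zetaSgn v : ℂ) * (pairSgn v i : ℂ)) * h7
          - (pairSgn v i : ℂ) * (pairSgn v r : ℂ) * h9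
  · rw [sum_partner_eq_zero hij, sub_zero]
    by_cases hri : i = r
    · subst hri
      rw [lie_lie_eta_self, if_pos rfl]
      by_cases hij' : i = j
      · subst hij'
        rw [if_pos rfl, xiRoot_self, ← two_smul ℂ]
        norm_num
      · rw [if_neg (Ne.symm hij'), ((form_xiRoot i j).2 hij').resolve_left hij]
        simp
    rw [if_neg hri, zero_add]
    rcases (form_xiRoot r i).2 (Ne.symm hri) with h1 | h1
    · rw [lie_xi_eta_of_form_eq_zero h1, zero_lie, if_neg]
      rintro rfl
      rw [form_comm] at h1
      exact hij h1
    · rw [lie_lie_eta_of_form_eq_one h1]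
      by_cases hrj : j = r
      · subst hrj
        have h2 : form (xiRoot i) (xiRoot j) = 1 := by rw [form_comm, h1]
        have h3 := sgnF_mul_self (xiRoot j) (xiRoot i)
        rw [if_pos (by rw [xiRoot_self, h2]; norm_num), if_pos rfl, sgnF_self _ (xiRoot_self j),
          sgnF_swap_odd (xiRoot j) (xiRoot i) (by rw [h1]; decide)]
        have h4 : xiRoot j + -xiRoot i + -xiRoot j = -xiRoot i := by abel
        rw [h4, ← eta]
        nth_rewrite 2 [← one_smul ℂ (eta i)]
        congr 1
        linear_combination h3
      · rw [if_neg hrj, if_neg]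
        have h2 := (form_xiRoot r j).2 (Ne.symm hrj)
        by_cases hij' : i = j
        · subst hij'
          rw [xiRoot_self]
          omega
        · have := ((form_xiRoot i j).2 hij').resolve_left hij
          omega

/-! ### The quadrics `ζ_v` and the vector fields `P_i` -/

set_option maxHeartbeats 4000000 in
-- The factor 2 arises because each monomial appears once for each of its two variables.
theorem two_mul_zeta (v : Fin 10) :
    2 * zeta (v + 1) = ∑ i, (pairSgn v i : A) * (X i * X (partner v i)) := by
  fin_cases v <;>
  · simp only [zeta, x, Fin.ofNat, Nat.reduceAdd, Fin.sum_univ_succ, Finset.univ_eq_empty,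
      Finset.sum_empty, pairSgn, partner]
    simp [Fin.succ]
    ring

set_option maxHeartbeats 4000000 in
-- One formula replaces the sixteen explicit ones, so that later arguments need only the symmetries
-- of `partner` and `pairSgn`.
theorem P_apply (i : Fin 16) (f : A) : P i f = X i * deg f
    - ∑ v : Fin 10, (pairSgn v i : A) * (zeta (v + 1) * pderiv (partner v i) f) := by
  fin_cases i <;>
  · simp only [P, Fin.sum_univ_succ, Finset.univ_eq_empty, Finset.sum_empty, pairSgn, partner, x,
      dx, Fin.ofNat]
    simp [Fin.succ]
    try ring

/-! ### Linear relations between the quadrics -/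

/-- The coefficient of `ζ_v` in the relation attached to `(w, j)` among the products of the `ζ_v`
with the variables. -/
def relSgn (w : Fin 10) (j : Fin 16) (v : Fin 10) : ℤ :=
  if v = w then -1 else pairSgn v j * pairSgn w (partner v j)

/-- The variable multiplied by `ζ_v` in the relation attached to `(w, j)`. -/
def relIdx (w : Fin 10) (j : Fin 16) (v : Fin 10) : Fin 16 :=
  if v = w then j else partner w (partner v j)

/-- One representative `(w, j)` for each of the sixteen relations. -/
def relRep : Fin 16 → Fin 10 × Fin 16 :=
  ![(0, 6), (0, 7), (0, 9), (0, 11), (0, 12), (0, 13), (0, 14), (0, 15), (1, 11), (1, 13),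
    (1, 14), (1, 15), (2, 14), (2, 15), (3, 15), (4, 15)]

set_option maxHeartbeats 4000000 in
-- In terms of `D₅`, the quadrics form a vector-valued covariant of a spinor, and the sixteen
-- identities say that Clifford multiplication of the spinor by this vector gives zero.
theorem relation_relRep (k : Fin 16) :
    ∑ v : Fin 10, (relSgn (relRep k).1 (relRep k).2 v : A)
      * (zeta (v + 1) * X (relIdx (relRep k).1 (relRep k).2 v)) = 0 := by
  fin_cases k <;>
  · simp only [Fin.sum_univ_succ, Finset.univ_eq_empty, Finset.sum_empty, pairSgn, partner,
      relRep, relSgn, relIdx]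
    simp [Fin.succ]
    simp only [zeta, x, Fin.ofNat, Nat.reduceMod, Nat.reduceSub, Fin.reduceFinMk]
    ring

/-- On the variables of one quadric, `partner v` is an involution that preserves the sign, so it may
be used to reindex the sum. -/
theorem sum_partner_swap (v : Fin 10) (F : Fin 16 → Fin 16 → A) :
    ∑ i, (pairSgn v i : A) * F i (partner v i) = ∑ i, (pairSgn v i : A) * F (partner v i) i := by
  have hs : ∀ f : Fin 16 → A, ∑ i, (pairSgn v i : A) * f i =
      ∑ i ∈ Finset.univ.filter (fun i => pairSgn v i ≠ 0), (pairSgn v i : A) * f i := by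
    intro f
    refine (Finset.sum_subset (Finset.filter_subset _ _) fun i _ hi => ?_).symm
    have : pairSgn v i = 0 := by simpa using hi
    simp [this]
  rw [hs, hs]
  refine Finset.sum_nbij' (partner v) (partner v) ?_ ?_ ?_ ?_ ?_ <;> intro i hi <;>
    obtain ⟨h1, h2⟩ := partner_partner v i (Finset.mem_filter.1 hi).2
  · exact Finset.mem_filter.2 ⟨Finset.mem_univ _, h2 ▸ (Finset.mem_filter.1 hi).2⟩
  · exact Finset.mem_filter.2 ⟨Finset.mem_univ _, h2 ▸ (Finset.mem_filter.1 hi).2⟩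
  · exact h1
  · exact h1
  · rw [h1, h2]

theorem intCast_eq_C (z : ℤ) : (z : A) = C (z : ℂ) := (map_intCast (C : ℂ →+* A) z).symm

theorem pderiv_X_eq (i j : Fin 16) : pderiv i (X j : A) = if i = j then 1 else 0 := by
  rw [pderiv_X, Pi.single_apply]
  simp only [eq_comm]

theorem pderiv_zeta (v : Fin 10) (i : Fin 16) :
    pderiv i (zeta (v + 1)) = (pairSgn v i : A) * X (partner v i) := by
  have h := congrArg (pderiv i) (two_mul_zeta v)
  have h2 : (2 : A) = C 2 := (map_ofNat C 2).symm
  rw [h2, pderiv_C_mul, ← h2, map_sum] at h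
  have h3 : ∀ j, pderiv i ((pairSgn v j : A) * (X j * X (partner v j))) =
      (pairSgn v j : A) * (X (partner v j) * pderiv i (X j))
        + (pairSgn v j : A) * (X j * pderiv i (X (partner v j))) := by
    intro j
    have : ((pairSgn v j : ℤ) : A) = C ((pairSgn v j : ℤ) : ℂ) := intCast_eq_C _
    rw [this, pderiv_C_mul, pderiv_mul]
    ring
  rw [Finset.sum_congr rfl fun j _ => h3 j, Finset.sum_add_distrib,
    sum_partner_swap v fun a b => X a * pderiv i (X b), ← two_mul] at h
  have h4 := mul_left_cancel₀ two_ne_zero h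
  rw [h4, Finset.sum_eq_single i]
  · rw [pderiv_X_self, mul_one]
  · intro j _ hj
    rw [pderiv_X_of_ne hj, mul_zero, mul_zero]
  · simp

theorem derivation_sum_apply {ι : Type*} (s : Finset ι) (D : ι → Derivation ℂ A A) (f : A) :
    (∑ i ∈ s, D i) f = ∑ i ∈ s, D i f := by
  classical
  induction s using Finset.induction_on with
  | empty => simp
  | insert a s ha ih =>
    rw [Finset.sum_insert ha, Finset.sum_insert ha, Derivation.add_apply, ih]

theorem deg_apply (f : A) : deg f = ∑ i, X i * pderiv i f := by
  rw [deg, derivation_sum_apply]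
  rfl

theorem deg_X (j : Fin 16) : deg (X j : A) = X j := by
  simp only [deg_apply, pderiv_X_eq]
  simp

theorem P_X (i j : Fin 16) : P i (X j) = X i * X j
    - ∑ v : Fin 10, if partner v i = j then (pairSgn v i : A) * zeta (v + 1) else 0 := by
  rw [P_apply, deg_X]
  refine congrArg₂ (· - ·) rfl (Finset.sum_congr rfl fun v _ => ?_)
  rw [pderiv_X_eq]
  split_ifs <;> simp

/-- The right side is that of `lie_lie_eta` with `η_k` replaced by `X k`. This agreement is what
makes `vfield` compatible with `[ξ_r, η_i]`. -/
theorem pderiv_P_X (r i j : Fin 16) : pderiv r (P i (X j)) =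
    (if i = r then X j else 0) + (if j = r then X i else 0)
      - ∑ v, if partner v i = j then
          ((pairSgn v i * pairSgn v r : ℤ) : ℂ) • (X (partner v r) : A) else 0 := by
  rw [P_X, map_sub, pderiv_mul, pderiv_X_eq, pderiv_X_eq, map_sum]
  refine congrArg₂ (· - ·) ?_ ?_
  · simp only [eq_comm (a := r)]
    split_ifs <;> simp [add_comm]
  · refine Finset.sum_congr rfl fun v _ => ?_
    split_ifs
    · have : ((pairSgn v i : ℤ) : A) = C ((pairSgn v i : ℤ) : ℂ) := intCast_eq_C _
      rw [this, pderiv_C_mul, pderiv_zeta, smul_eq_C_mul]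
      push_cast
      rw [map_mul, map_intCast, map_intCast, mul_assoc]
    · simp

/-- Every pair `(w, j)` with `x_j` absent from `ζ_w` occurs in one of the sixteen listed relations,
and its own relation is that one up to sign. So the polynomial identities need checking only for the
representatives. -/
theorem exists_relRep : ∀ w j, pairSgn w j = 0 → ∃ k,
    relIdx (relRep k).1 (relRep k).2 w = j ∧
    relSgn (relRep k).1 (relRep k).2 w * relSgn (relRep k).1 (relRep k).2 w = 1 ∧
    ∀ v, v ≠ w → pairSgn v j * pairSgn w (partner v j) =
      -(relSgn (relRep k).1 (relRep k).2 w * relSgn (relRep k).1 (relRep k).2 v) ∧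
      (relSgn (relRep k).1 (relRep k).2 v ≠ 0 →
        partner w (partner v j) = relIdx (relRep k).1 (relRep k).2 v) := by
  decide +kernel

/-- If both factors were nonzero, the vectors `pairWt v` and `pairWt w`, each of norm 4, would have
product `2 + 2 = 4` and hence coincide. -/
theorem pairSgn_mul_eq_zero : ∀ w j, pairSgn w j ≠ 0 → ∀ v, v ≠ w →
    pairSgn v j * pairSgn w (partner v j) = 0 := by
  decide +kernel

theorem sum_zeta_mul_X (w : Fin 10) (j : Fin 16) :
    ∑ v : Fin 10, ((pairSgn v j * pairSgn w (partner v j) : ℤ) : A)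
      * (zeta (v + 1) * X (partner w (partner v j))) = zeta (w + 1) * X j := by
  -- If `x_j` does not occur in `ζ_w`, the term `v = w` drops out and the identity is the relation
  -- of `(w, j)` solved for `ζ_w x_j`. If it does occur, only the term `v = w` survives.
  by_cases h : pairSgn w j = 0
  · obtain ⟨k, h1, h2, h3⟩ := exists_relRep w j h
    have hrel := relation_relRep k
    have h2' : ((relSgn (relRep k).1 (relRep k).2 w : ℤ) : A)
        * ((relSgn (relRep k).1 (relRep k).2 w : ℤ) : A) = 1 := by exact_mod_cast h2
    rw [← Finset.add_sum_erase _ _ (Finset.mem_univ w)] at hrel ⊢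
    rw [h, zero_mul, Int.cast_zero, zero_mul, zero_add]
    rw [h1] at hrel
    have h4 : ∀ v ∈ Finset.univ.erase w, ((pairSgn v j * pairSgn w (partner v j) : ℤ) : A)
        * (zeta (v + 1) * X (partner w (partner v j))) =
        -((relSgn (relRep k).1 (relRep k).2 w : ℤ) : A) *
          ((relSgn (relRep k).1 (relRep k).2 v : A)
            * (zeta (v + 1) * X (relIdx (relRep k).1 (relRep k).2 v))) := by
      intro v hv
      obtain ⟨h5, h6⟩ := h3 v (Finset.ne_of_mem_erase hv)
      rw [h5]
      by_cases h7 : relSgn (relRep k).1 (relRep k).2 v = 0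
      · simp [h7]
      · rw [h6 h7]
        push_cast
        ring
    rw [Finset.sum_congr rfl h4, ← Finset.mul_sum]
    linear_combination (-((relSgn (relRep k).1 (relRep k).2 w : ℤ) : A)) * hrel
      + zeta (w + 1) * X j * h2'
  · obtain ⟨h1, h2⟩ := partner_partner w j h
    rw [Finset.sum_eq_single w, h1, h2, pairSgn_sq w j h]
    · simp
    · intro v _ hv
      rw [pairSgn_mul_eq_zero w j h v hv]
      simp
    · simp

/-! ### Contraction of the `P_i` with the differentials of the quadrics -/

/-- The Euler part of the `P_i` contributes `2 ζ_w deg g`. The relations of `sum_zeta_mul_X`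
collapse the quadric part to `ζ_w deg g`, and the difference remains. -/
theorem sum_pairSgn_mul_P (w : Fin 10) (g : A) :
    ∑ i, (pairSgn w i : A) * (X (partner w i) * P i g) = zeta (w + 1) * deg g := by
  have h1 : ∀ i, (pairSgn w i : A) * (X (partner w i) * P i g) =
      (pairSgn w i : A) * (X i * X (partner w i)) * deg g
      - ∑ v : Fin 10, (pairSgn v i : A) * ((pairSgn w i : A) *
        (zeta (v + 1) * X (partner w i) * pderiv (partner v i) g)) := by
    intro i
    rw [P_apply, mul_sub, mul_sub, Finset.mul_sum, Finset.mul_sum]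
    exact congrArg₂ (· - ·) (by ring) (Finset.sum_congr rfl fun v _ => by ring)
  have h2 : ∀ v : Fin 10, ∑ i, (pairSgn v i : A) * ((pairSgn w i : A) *
        (zeta (v + 1) * X (partner w i) * pderiv (partner v i) g)) =
      ∑ j, ((pairSgn v j * pairSgn w (partner v j) : ℤ) : A)
        * (zeta (v + 1) * X (partner w (partner v j))) * pderiv j g := by
    intro v
    -- Reindexing by `partner v` makes the derivative `∂_j` independent of `v`, so that the sum over
    -- `v` can be evaluated for fixed `j`.
    rw [sum_partner_swap v fun a b => (pairSgn w a : A) *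
      (zeta (v + 1) * X (partner w a) * pderiv b g)]
    exact Finset.sum_congr rfl fun v _ => by push_cast; ring
  rw [Finset.sum_congr rfl fun i _ => h1 i, Finset.sum_sub_distrib, ← Finset.sum_mul,
    ← two_mul_zeta, Finset.sum_comm, Finset.sum_congr rfl fun v _ => h2 v, Finset.sum_comm]
  have h3 : ∀ j, ∑ v : Fin 10, ((pairSgn v j * pairSgn w (partner v j) : ℤ) : A)
      * (zeta (v + 1) * X (partner w (partner v j))) * pderiv j g =
      zeta (w + 1) * (X j * pderiv j g) := fun j => by
    rw [← Finset.sum_mul, sum_zeta_mul_X, mul_assoc]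
  rw [Finset.sum_congr rfl fun j _ => h3 j, ← Finset.mul_sum, ← deg_apply]
  ring

theorem sum_pairSgn_sq : ∀ w, ∑ i, pairSgn w i * pairSgn w i = 8 := by decide +kernel

/-- The products `X i * X (partner w i)` add up to `2 ζ_w`, and each of the eight variables of `ζ_w`
contributes a further `-ζ_w`. -/
theorem sum_pairSgn_mul_P_X (w : Fin 10) :
    ∑ i, (pairSgn w i : A) * P i (X (partner w i)) = -6 * zeta (w + 1) := by
  have h1 : ∀ i, (pairSgn w i : A) * P i (X (partner w i)) =
      (pairSgn w i : A) * (X i * X (partner w i))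
        - ((pairSgn w i * pairSgn w i : ℤ) : A) * zeta (w + 1) := by
    intro i
    by_cases h : pairSgn w i = 0
    · simp [h]
    · rw [P_X, Finset.sum_eq_single w, if_pos rfl]
      · push_cast; ring
      · intro v _ hv
        split_ifs with h2
        · by_cases h3 : pairSgn v i = 0
          · simp [h3]
          · refine absurd (pairWt_injective ?_) hv
            rw [← xiRoot_add_partner' h3, ← xiRoot_add_partner' h, h2]
        · rfl
      · simp
  rw [Finset.sum_congr rfl fun i _ => h1 i, Finset.sum_sub_distrib, ← two_mul_zeta,
    ← Finset.sum_mul, ← Int.cast_sum, sum_pairSgn_sq]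
  push_cast
  ring

/-- The vector fields `P_i`, contracted with the differential of `ζ_w`. -/
theorem sum_P_pderiv_zeta_mul (w : Fin 10) (g : A) :
    ∑ i, P i (pderiv i (zeta (w + 1)) * g) = zeta (w + 1) * (deg g - 6 * g) := by
  have h1 : ∀ i, P i (pderiv i (zeta (w + 1)) * g) =
      (pairSgn w i : A) * P i (X (partner w i)) * g
        + (pairSgn w i : A) * (X (partner w i) * P i g) := by
    intro i
    have : ((pairSgn w i : ℤ) : A) = C ((pairSgn w i : ℤ) : ℂ) := intCast_eq_C _
    rw [pderiv_zeta, Derivation.leibniz, this, Derivation.leibniz, derivation_C]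
    simp only [smul_eq_mul]
    ring
  rw [Finset.sum_congr rfl fun i _ => h1 i, Finset.sum_add_distrib, ← Finset.sum_mul,
    sum_pairSgn_mul_P_X, sum_pairSgn_mul_P]
  ring

theorem sum_P_pderiv (f : A) : ∑ i, P i (pderiv i f) = ∑ i, X i * deg (pderiv i f)
    - ∑ v : Fin 10, zeta (v + 1) * ∑ i, (pairSgn v i : A) * pderiv (partner v i) (pderiv i f) := by
  simp only [P_apply, Finset.sum_sub_distrib, Finset.mul_sum]
  rw [Finset.sum_comm (s := (Finset.univ : Finset (Fin 16)))]
  exact congrArg₂ (· - ·) rfl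
    (Finset.sum_congr rfl fun v _ => Finset.sum_congr rfl fun i _ => by ring)

/-! ### The realization of `G` by vector fields -/

/-- The linear form on `G` with values in the linear polynomials that maps `η_i` to `X i`. -/
def etaX : G →ₗ[ℂ] A := ∑ j, (coeffL (-xiRoot j)).smulRight (X j)

theorem etaX_apply (y : G) : etaX y = ∑ j, coeffE (-xiRoot j) y • (X j : A) := by
  simp [etaX, coeffL_apply]

theorem coeffE_neg_eta (i j : Fin 16) : coeffE (-xiRoot j) (eta i) = if i = j then 1 else 0 := by
  rw [eta, coeffE_E _ _ (neg_xiRoot_self i)]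
  simp [xiRoot_injective.eq_iff]

theorem coeffE_xi (i j : Fin 16) : coeffE (xiRoot j) (xi i) = if i = j then 1 else 0 := by
  rw [xi, coeffE_E _ _ (xiRoot_self i)]
  simp [xiRoot_injective.eq_iff]

theorem etaX_eta (i : Fin 16) : etaX (eta i) = X i := by
  simp [etaX_apply, coeffE_neg_eta]

theorem etaX_of_mem_grade {k : ℤ} (hk : k ≠ -1) {y : G} (hy : y ∈ grade k) : etaX y = 0 := by
  rw [etaX_apply]
  refine Finset.sum_eq_zero fun j _ => ?_
  rw [coeffE_grade hy _ (by simp [xiRoot_five]; omega), zero_smul]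

theorem zeroPart_add (x y : G) : zeroPart (x + y) = zeroPart x + zeroPart y := by
  simp only [zeroPart, map_add, Finsupp.filter_add]
  abel

theorem zeroPart_smul (r : ℂ) (x : G) : zeroPart (r • x) = r • zeroPart x := by
  simp only [zeroPart, map_smul, Finsupp.filter_smul, smul_add]

theorem actA_add (x y : G) : actA (x + y) = actA x + actA y := by
  simp only [actA, ← coeffL_apply, add_lie, map_add, add_smul, Finset.sum_add_distrib]

theorem actA_smul (r : ℂ) (x : G) : actA (r • x) = r • actA x := by
  simp only [actA, ← coeffL_apply, smul_lie, map_smul, Finset.smul_sum, smul_assoc]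

theorem actA_X (u : G) (i : Fin 16) : actA u (X i) = etaX ⁅u, eta i⁆ := by
  rw [actA, derivation_sum_apply, Finset.sum_eq_single i]
  · rw [derivation_sum_apply, etaX_apply]
    refine Finset.sum_congr rfl fun j _ => ?_
    rw [Derivation.smul_apply, Derivation.smul_apply, pderiv_X_self, smul_eq_mul, mul_one]
  · intro j _ hj
    rw [derivation_sum_apply]
    refine Finset.sum_eq_zero fun k _ => ?_
    rw [Derivation.smul_apply, Derivation.smul_apply, pderiv_X_of_ne hj.symm, smul_zero, smul_zero]
  · simp

/-- The vector field by which an element of `G` acts. -/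
def vfield : G →ₗ[ℂ] Derivation ℂ A A where
  toFun g := actA (zeroPart g) + ∑ i, coeffE (xiRoot i) g • (pderiv i : Derivation ℂ A A)
    + ∑ i, coeffE (-xiRoot i) g • P i
  map_add' x y := by
    simp only [zeroPart_add, actA_add, ← coeffL_apply, map_add, add_smul, Finset.sum_add_distrib]
    abel
  map_smul' r x := by
    simp only [zeroPart_smul, actA_smul, ← coeffL_apply, map_smul, smul_assoc, Finset.smul_sum,
      smul_add, RingHom.id_apply]

theorem vfield_apply (g : G) : vfield g = actA (zeroPart g)
    + ∑ i, coeffE (xiRoot i) g • (pderiv i : Derivation ℂ A A)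
    + ∑ i, coeffE (-xiRoot i) g • P i := rfl

theorem actA_zero : actA 0 = 0 := by
  simpa using actA_smul 0 0

theorem vfield_of_mem_grade_zero {u : G} (hu : u ∈ grade 0) : vfield u = actA u := by
  rw [vfield_apply, zeroPart_eq_self hu]
  simp [coeffE_grade hu _ (show xiRoot _ 5 ≠ 0 by simp [xiRoot_five]),
    coeffE_grade hu _ (show (-xiRoot _) 5 ≠ 0 by simp [xiRoot_five])]

theorem vfield_xi (i : Fin 16) : vfield (xi i) = pderiv i := by
  rw [vfield_apply, zeroPart_eq_zero (xi_mem_grade i) one_ne_zero, actA_zero]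
  simp [coeffE_xi,
    coeffE_grade (xi_mem_grade i) _ (show (-xiRoot _) 5 ≠ 1 by simp [xiRoot_five])]

theorem vfield_eta (i : Fin 16) : vfield (eta i) = P i := by
  rw [vfield_apply, zeroPart_eq_zero (eta_mem_grade i) (by norm_num), actA_zero]
  simp [coeffE_neg_eta,
    coeffE_grade (eta_mem_grade i) _ (show xiRoot _ 5 ≠ -1 by simp [xiRoot_five])]

section Derivation

/-! The laws of the bracket of derivations, stated for `Derivation.instBracket`. -/

variable (D₁ D₂ D₃ : Derivation ℂ A A)

theorem derivation_lie_sub : ⁅D₁, D₂ - D₃⁆ = ⁅D₁, D₂⁆ - ⁅D₁, D₃⁆ := lie_sub D₁ D₂ D₃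

theorem derivation_add_lie : ⁅D₁ + D₂, D₃⁆ = ⁅D₁, D₃⁆ + ⁅D₂, D₃⁆ := add_lie D₁ D₂ D₃

theorem derivation_smul_lie (r : ℂ) : ⁅r • D₁, D₂⁆ = r • ⁅D₁, D₂⁆ := smul_lie r D₁ D₂

theorem derivation_lie_smul (r : ℂ) : ⁅D₁, r • D₂⁆ = r • ⁅D₁, D₂⁆ := lie_smul r D₁ D₂

theorem derivation_lie_zero : ⁅D₁, (0 : Derivation ℂ A A)⁆ = 0 := lie_zero D₁

theorem derivation_leibniz_lie : ⁅D₁, ⁅D₂, D₃⁆⁆ = ⁅⁅D₁, D₂⁆, D₃⁆ + ⁅D₂, ⁅D₁, D₃⁆⁆ :=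
  LieRing.leibniz_lie D₁ D₂ D₃

theorem derivation_sum_lie {ι : Type*} (s : Finset ι) (D : ι → Derivation ℂ A A) :
    ⁅∑ i ∈ s, D i, D₁⁆ = ∑ i ∈ s, ⁅D i, D₁⁆ := sum_lie s D D₁

theorem derivation_lie_sum {ι : Type*} (s : Finset ι) (D : ι → Derivation ℂ A A) :
    ⁅D₁, ∑ i ∈ s, D i⁆ = ∑ i ∈ s, ⁅D₁, D i⁆ := lie_sum s D D₁

end Derivation

/-! ### The map to vector fields is a homomorphism -/

/-- Compatibility of `vfield` with the bracket of the components of degrees `k` and `l`. -/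
def IsHomOn (k l : ℤ) : Prop :=
  ∀ g ∈ grade k, ∀ h ∈ grade l, vfield ⁅g, h⁆ = ⁅vfield g, vfield h⁆

theorem IsHomOn.map_lie {k l : ℤ} (H : IsHomOn k l) {g h : G} (hg : g ∈ grade k)
    (hh : h ∈ grade l) : vfield ⁅g, h⁆ = ⁅vfield g, vfield h⁆ := H g hg h hh

theorem IsHomOn.symm {k l : ℤ} (H : IsHomOn k l) : IsHomOn l k := fun g hg h hh => by
  rw [← lie_skew, map_neg, H h hh g hg, lie_skew]

theorem isHomOn_one {l : ℤ}
    (H : ∀ i, ∀ h ∈ grade l, vfield ⁅xi i, h⁆ = ⁅vfield (xi i), vfield h⁆) : IsHomOn 1 l := by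
  intro g hg h hh
  rw [eq_sum_xi hg]
  simp only [sum_lie, map_sum, smul_lie, map_smul, H _ h hh, derivation_sum_lie,
    derivation_smul_lie]

theorem pderiv_etaX (r : Fin 16) (y : G) : pderiv r (etaX y) = C (coeffE (-xiRoot r) y) := by
  rw [etaX_apply, map_sum, Finset.sum_eq_single r]
  · rw [Derivation.map_smul, pderiv_X_self, smul_eq_C_mul, mul_one]
  · intro j _ hj
    rw [Derivation.map_smul, pderiv_X_of_ne hj, smul_zero]
  · simp

theorem derivation_pderiv_X (D : Derivation ℂ A A) (r i : Fin 16) : D (pderiv r (X i)) = 0 := by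
  rw [pderiv_X_eq]
  split_ifs <;> simp

/-- On a variable both sides are constants: a coefficient of the action of `u` on `G₁` and one on
`G₋₁`, which agree by the duality `coeffE_lie_xi`. -/
theorem isHomOn_one_zero : IsHomOn 1 0 := by
  refine isHomOn_one fun r u hu => derivation_ext fun i => ?_
  rw [eq_sum_xi (lie_mem_grade (add_zero 1) (xi_mem_grade r) hu), map_sum, derivation_sum_apply,
    Finset.sum_eq_single i, Derivation.commutator_apply, vfield_of_mem_grade_zero hu,
    vfield_xi, derivation_pderiv_X, sub_zero, actA_X, pderiv_etaX, map_smul, vfield_xi,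
    Derivation.smul_apply, pderiv_X_self, smul_eq_C_mul, mul_one]
  · rw [← lie_skew, ← coeffL_apply, map_neg, coeffL_apply, coeffE_lie_xi, neg_neg]
  · intro j _ hj
    rw [map_smul, vfield_xi, Derivation.smul_apply, pderiv_X_of_ne hj.symm, smul_zero]
  · simp

theorem lie_eq_zero_of_mem_grade {k l : ℤ} (hkl : 1 < |k + l|) {y z : G} (hy : y ∈ grade k)
    (hz : z ∈ grade l) : ⁅y, z⁆ = 0 :=
  eq_zero_of_mem_grade (lie_mem_grade rfl hy hz) hkl

theorem isHomOn_one_one : IsHomOn 1 1 := by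
  refine isHomOn_one fun i h hh => ?_
  rw [lie_eq_zero_of_mem_grade (by norm_num) (xi_mem_grade i) hh, eq_sum_xi hh]
  simp only [map_sum, map_smul, vfield_xi, derivation_lie_sum, derivation_lie_smul, map_zero]
  refine (Finset.sum_eq_zero fun j _ => ?_).symm
  have : ⁅(pderiv i : Derivation ℂ A A), pderiv j⁆ = 0 := derivation_ext fun k => by
    rw [Derivation.commutator_apply, derivation_pderiv_X, derivation_pderiv_X]
    simp
  rw [this, smul_zero]

theorem isHomOn_one_neg_one : IsHomOn 1 (-1) := by
  refine isHomOn_one fun r h hh => ?_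
  have key : ∀ i, vfield ⁅xi r, eta i⁆ = ⁅vfield (xi r), vfield (eta i)⁆ := by
    intro i
    refine derivation_ext fun j => ?_
    rw [vfield_of_mem_grade_zero (lie_mem_grade (by norm_num) (xi_mem_grade r) (eta_mem_grade i)),
      actA_X, lie_lie_eta, Derivation.commutator_apply, vfield_xi, vfield_eta,
      derivation_pderiv_X, sub_zero, pderiv_P_X, map_sub, map_add, map_sum]
    simp only [apply_ite etaX, map_zero, map_smul, etaX_eta]
  rw [eq_sum_eta hh]
  simp only [lie_sum, map_sum, lie_smul, map_smul, key, derivation_lie_sum, derivation_lie_smul]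

theorem eq_C_of_pderiv_eq_zero (f : A) (h : ∀ i, pderiv i f = 0) : f = C (constantCoeff f) := by
  ext m
  rw [coeff_C]
  split_ifs with hm
  · rw [← hm]
    rfl
  · obtain ⟨i, hi⟩ : ∃ i, m i ≠ 0 := by
      by_contra! H
      exact hm (Finsupp.ext H).symm
    -- In characteristic zero, the coefficient of `m` in `f` is detected by that of `m - eᵢ` in `∂ᵢ
    -- f`.
    have h1 := coeff_pderiv (i := i) f (m - Finsupp.single i 1)
    rw [h i, coeff_zero, tsub_add_cancel_of_le
      (Finsupp.single_le_iff.2 (Nat.one_le_iff_ne_zero.2 hi))] at h1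
    refine (mul_eq_zero.1 h1.symm).resolve_right ?_
    exact Nat.cast_add_one_ne_zero _

/-- Commuting with every `∂_r` forces constant coefficients, and vanishing at the origin makes them
zero. -/
theorem derivation_eq_zero {Q : Derivation ℂ A A}
    (h : ∀ r, ⁅(pderiv r : Derivation ℂ A A), Q⁆ = 0) (h0 : ∀ f, constantCoeff (Q f) = 0) :
    Q = 0 := by
  refine derivation_ext fun j => ?_
  rw [eq_C_of_pderiv_eq_zero (Q (X j)), h0]
  · simp
  · intro r
    have h1 := congrArg (fun D : Derivation ℂ A A => D (X j)) (h r)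
    simp only [Derivation.commutator_apply, derivation_pderiv_X, sub_zero] at h1
    simpa using h1

theorem constantCoeff_derivation {D : Derivation ℂ A A} (h : ∀ j, constantCoeff (D (X j)) = 0)
    (f : A) : constantCoeff (D f) = 0 := by
  induction f using MvPolynomial.induction_on with
  | C a => simp
  | add p q hp hq => rw [map_add, map_add, hp, hq, add_zero]
  | mul_X p i hp =>
    rw [Derivation.leibniz, map_add, smul_eq_mul, smul_eq_mul, map_mul, map_mul, h, hp]
    simp

theorem constantCoeff_zeta (v : Fin 10) : constantCoeff (zeta (v + 1)) = 0 := by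
  have h := congrArg constantCoeff (two_mul_zeta v)
  rw [map_mul, map_sum, Finset.sum_eq_zero fun i _ => by simp, map_ofNat] at h
  exact (mul_eq_zero.1 h).resolve_left two_ne_zero

/-- The elements of `grade k` act by vector fields that vanish at the origin. -/
def VanishesOn (k : ℤ) : Prop := ∀ g ∈ grade k, ∀ f, constantCoeff (vfield g f) = 0

theorem vanishesOn_zero : VanishesOn 0 := by
  intro g hg
  refine constantCoeff_derivation fun j => ?_
  rw [vfield_of_mem_grade_zero hg, actA_X, etaX_apply, map_sum]
  exact Finset.sum_eq_zero fun i _ => by rw [constantCoeff_smul, constantCoeff_X, smul_zero]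

theorem vanishesOn_neg_one : VanishesOn (-1) := by
  intro g hg
  refine constantCoeff_derivation fun j => ?_
  rw [eq_sum_eta hg, map_sum, derivation_sum_apply, map_sum]
  refine Finset.sum_eq_zero fun i _ => ?_
  rw [map_smul, Derivation.smul_apply, constantCoeff_smul, vfield_eta, P_X, map_sub, map_sum,
    Finset.sum_eq_zero, map_mul, constantCoeff_X]
  · simp
  · intro v _
    split_ifs
    · rw [map_mul, constantCoeff_zeta, mul_zero]
    · simp

theorem vanishesOn_neg_two : VanishesOn (-2) := by
  intro g hg f
  rw [eq_zero_of_mem_grade hg (by norm_num)]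
  simp

/-- A vector field that vanishes at the origin is determined by its brackets with the partial
derivatives, so that `IsHomOn` can be proved by descending induction on the degrees. -/
theorem isHomOn_of_succ {k l k' l' m : ℤ} (hk : 1 + k = k') (hl : 1 + l = l') (hm : k + l = m)
    (H1 : IsHomOn 1 k) (H2 : IsHomOn 1 l) (H3 : IsHomOn k' l) (H4 : IsHomOn k l')
    (H5 : IsHomOn 1 m) (V1 : VanishesOn k) (V2 : VanishesOn l) (V3 : VanishesOn m) :
    IsHomOn k l := by
  intro g hg h hh
  rw [← sub_eq_zero]
  refine derivation_eq_zero (fun r => ?_) fun f => ?_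
  · have hx := xi_mem_grade r
    rw [← vfield_xi r, derivation_lie_sub, ← H5 _ hx _ (lie_mem_grade hm hg hh), leibniz_lie,
      derivation_leibniz_lie, ← H1 _ hx _ hg, ← H2 _ hx _ hh, ← H3 _ (lie_mem_grade hk hx hg) _ hh,
      ← H4 _ hg _ (lie_mem_grade hl hx hh), map_add, sub_self]
  · rw [Derivation.sub_apply, Derivation.commutator_apply, map_sub, map_sub,
      V3 _ (lie_mem_grade hm hg hh), V1 _ hg, V2 _ hh]
    simp

theorem isHomOn_zero_zero : IsHomOn 0 0 :=
  isHomOn_of_succ (add_zero 1) (add_zero 1) (add_zero 0) isHomOn_one_zero isHomOn_one_zero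
    isHomOn_one_zero isHomOn_one_zero.symm isHomOn_one_zero vanishesOn_zero vanishesOn_zero
    vanishesOn_zero

theorem isHomOn_zero_neg_one : IsHomOn 0 (-1) :=
  isHomOn_of_succ (k' := 1) (l' := 0) (m := -1) (by norm_num) (by norm_num) (by norm_num)
    isHomOn_one_zero isHomOn_one_neg_one isHomOn_one_neg_one isHomOn_zero_zero
    isHomOn_one_neg_one vanishesOn_zero vanishesOn_neg_one vanishesOn_neg_one

theorem isHomOn_neg_one_neg_one : IsHomOn (-1) (-1) := by
  refine isHomOn_of_succ (k' := 0) (l' := 0) (m := -2) (by norm_num) (by norm_num) (by norm_num)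
    isHomOn_one_neg_one isHomOn_one_neg_one isHomOn_zero_neg_one isHomOn_zero_neg_one.symm
    ?_ vanishesOn_neg_one vanishesOn_neg_one vanishesOn_neg_two
  intro g _ h hh
  rw [eq_zero_of_mem_grade hh (by norm_num), lie_zero, map_zero, derivation_lie_zero]

/-- A symmetric relation on `G` that is linear in each variable holds if it holds for homogeneous
elements. -/
theorem graded_induction₂ {p : G → G → Prop} (hsymm : ∀ x y, p x y → p y x)
    (hadd : ∀ x y z, p x z → p y z → p (x + y) z) (hsmul : ∀ (r : ℂ) x z, p x z → p (r • x) z)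
    (h00 : ∀ u ∈ grade 0, ∀ v ∈ grade 0, p u v) (h01 : ∀ u ∈ grade 0, ∀ i, p u (xi i))
    (h02 : ∀ u ∈ grade 0, ∀ i, p u (eta i)) (h11 : ∀ i j, p (xi i) (xi j))
    (h12 : ∀ i j, p (xi i) (eta j)) (h22 : ∀ i j, p (eta i) (eta j)) (x y : G) : p x y := by
  have hadd' : ∀ z x y, p z x → p z y → p z (x + y) := fun z x y hx hy =>
    hsymm _ _ (hadd _ _ _ (hsymm _ _ hx) (hsymm _ _ hy))
  have hsmul' : ∀ (z : G) (r : ℂ) x, p z x → p z (r • x) := fun z r x hx =>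
    hsymm _ _ (hsmul _ _ _ (hsymm _ _ hx))
  refine graded_induction (p := fun x => p x y) (fun u hu => ?_) (fun i => ?_) (fun i => ?_)
    (fun x z => hadd x z y) (fun r x => hsmul r x y) x
  · exact graded_induction (h00 u hu) (h01 u hu) (h02 u hu) (hadd' u) (hsmul' u) y
  · exact graded_induction (fun u hu => hsymm _ _ (h01 u hu i)) (h11 i) (h12 i) (hadd' _)
      (hsmul' _) y
  · exact graded_induction (fun u hu => hsymm _ _ (h02 u hu i)) (fun j => hsymm _ _ (h12 j i))
      (h22 i) (hadd' _) (hsmul' _) y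

theorem vfield_lie (g h : G) : vfield ⁅g, h⁆ = ⁅vfield g, vfield h⁆ := by
  have hx := xi_mem_grade
  have he := eta_mem_grade
  refine graded_induction₂ (p := fun g h => vfield ⁅g, h⁆ = ⁅vfield g, vfield h⁆)
    ?_ ?_ ?_ ?_ ?_ ?_ ?_ ?_ ?_ g h
  · intro x y h
    rw [← lie_skew, map_neg, h, lie_skew]
  · intro x y z hx hy
    rw [add_lie, map_add, map_add, derivation_add_lie, hx, hy]
  · intro r x z hx
    rw [smul_lie, map_smul, map_smul, derivation_smul_lie, hx]
  · intro u hu v hv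
    exact isHomOn_zero_zero.map_lie hu hv
  · intro u hu i
    exact isHomOn_one_zero.symm.map_lie hu (hx i)
  · intro u hu i
    exact isHomOn_zero_neg_one.map_lie hu (he i)
  · intro i j
    exact isHomOn_one_one.map_lie (hx i) (hx j)
  · intro i j
    exact isHomOn_one_neg_one.map_lie (hx i) (he j)
  · intro i j
    exact isHomOn_neg_one_neg_one.map_lie (he i) (he j)

/-! ### The twist by `c` -/

/-- The polynomial by which the operator of `g` differs from the vector field of `g`. -/
def twist (c : ℂ) : G →ₗ[ℂ] A :=
  ((c / 2) • (LinearMap.proj 5 ∘ₗ hPart)).smulRight (1 : A) - (c / 2) • etaX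

theorem twist_apply (c : ℂ) (g : G) : twist c g = C (c / 2 * hPart g 5) - (c / 2) • etaX g := by
  simp [twist, smul_eq_C_mul]

theorem twist_of_mem_grade_zero (c : ℂ) {u : G} (hu : u ∈ grade 0) :
    twist c u = C (c / 2 * hPart u 5) := by
  rw [twist_apply, etaX_of_mem_grade (by norm_num) hu, smul_zero, sub_zero]

theorem twist_of_mem_grade_one (c : ℂ) {y : G} (hy : y ∈ grade 1) : twist c y = 0 := by
  rw [twist_apply, etaX_of_mem_grade (by norm_num) hy, hPart_eq_zero hy one_ne_zero]
  simp

theorem twist_of_mem_grade_neg_one (c : ℂ) {y : G} (hy : y ∈ grade (-1)) :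
    twist c y = -((c / 2) • etaX y) := by
  rw [twist_apply, hPart_eq_zero hy (by norm_num)]
  simp

/-- Since `α̂` is central in `G₀`, the bracket depends only on the `D₅`-components and stays in
`D₅`. So the `α₆`-coordinate is a character of `G₀`, as the cocycle property of `twist` in degree
zero requires. -/
theorem hPart_lie_five {u v : G} (hu : u ∈ grade 0) (hv : v ∈ grade 0) : hPart ⁅u, v⁆ 5 = 0 := by
  have hd : ∀ w ∈ grade 0, w = (d5Part w : G) + hatCoeff w • ofH alphaHat := by
    intro w hw
    conv_lhs => rw [← zeroPart_eq_self hw]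
    simp only [zeroPart, d5Part, map_sub, map_smul]
    abel
  have hz : ∀ w ∈ grade 0, ⁅ofH alphaHat, w⁆ = 0 := fun w hw => by simpa using mem_grade.1 hw
  have hz' : ∀ w ∈ grade 0, ⁅w, ofH alphaHat⁆ = 0 := fun w hw => by
    rw [← lie_skew, hz w hw, neg_zero]
  have h1 : ⁅u, v⁆ = ⁅(d5Part u : G), (d5Part v : G)⁆ := by
    have h2 : (d5Part u : G) = u - hatCoeff u • ofH alphaHat := by
      rw [eq_sub_iff_add_eq, ← hd u hu]
    have h3 : (d5Part v : G) = v - hatCoeff v • ofH alphaHat := by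
      rw [eq_sub_iff_add_eq, ← hd v hv]
    rw [h2, h3]
    simp [hz v hv, hz' u hu]
  rw [h1]
  exact (D5.lie_mem (d5Part u).2 (d5Part v).2).1

theorem hPart_lie_xi_eta (r i : Fin 16) : hPart ⁅xi r, eta i⁆ 5 = if r = i then -1 else 0 := by
  split_ifs with h
  · subst h
    rw [lie_xi_eta_self]
    simp [toC, xiRoot_five]
  · rcases (form_xiRoot r i).2 h with h1 | h1
    · rw [lie_xi_eta_of_form_eq_zero h1]
      simp
    · rw [lie_xi_eta_of_form_eq_one h1]
      simp

/-- This symmetry is the cocycle condition for `twist` on `(η_i, η_j)`, where the bracket vanishes.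
-/
theorem P_X_comm (i j : Fin 16) : P i (X j) = P j (X i) := by
  rw [P_X, P_X, mul_comm]
  refine congrArg₂ (· - ·) rfl (Finset.sum_congr rfl fun v _ => ?_)
  by_cases hi : pairSgn v i = 0
  · rw [hi, Int.cast_zero, zero_mul, ite_self]
    split_ifs with h
    · by_cases hj : pairSgn v j = 0
      · simp [hj]
      · have h1 := (partner_partner v j hj).2
        rw [h, hi] at h1
        exact absurd h1.symm hj
    · rfl
  · obtain ⟨h1, h2⟩ := partner_partner v i hi
    by_cases h : partner v i = j
    · rw [h] at h1 h2
      rw [if_pos h, if_pos h1, h2]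
    · rw [if_neg h]
      split_ifs with h3
      · by_cases hj : pairSgn v j = 0
        · simp [hj]
        · exact absurd (h3 ▸ (partner_partner v j hj).1) h
      · rfl

/-- The cocycle identity is exactly what lets the multiplication operators be added to the vector
fields without breaking the commutation relations (`op_lie`). -/
theorem twist_lie (c : ℂ) (g h : G) :
    twist c ⁅g, h⁆ = vfield g (twist c h) - vfield h (twist c g) := by
  have hx := xi_mem_grade
  have he := eta_mem_grade
  refine graded_induction₂
    (p := fun g h => twist c ⁅g, h⁆ = vfield g (twist c h) - vfield h (twist c g))
    ?_ ?_ ?_ ?_ ?_ ?_ ?_ ?_ ?_ g h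
  · intro x y h
    rw [← lie_skew, map_neg, h, neg_sub]
  · intro x y z hx hy
    rw [add_lie, map_add, map_add, map_add, map_add, hx, hy, Derivation.add_apply]
    abel
  · intro r x z hx
    rw [smul_lie, map_smul, map_smul, map_smul, hx, Derivation.smul_apply, Derivation.map_smul,
      smul_sub]
  · intro u hu v hv
    rw [twist_of_mem_grade_zero c (lie_mem_grade (add_zero 0) hu hv), hPart_lie_five hu hv,
      twist_of_mem_grade_zero c hu, twist_of_mem_grade_zero c hv]
    simp
  · intro u hu i
    rw [twist_of_mem_grade_one c (lie_mem_grade (zero_add 1) hu (hx i)),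
      twist_of_mem_grade_zero c hu, twist_of_mem_grade_one c (hx i)]
    simp
  · intro u hu i
    rw [twist_of_mem_grade_neg_one c (lie_mem_grade (zero_add (-1)) hu (he i)),
      twist_of_mem_grade_zero c hu, twist_of_mem_grade_neg_one c (he i), etaX_eta,
      derivation_C, sub_zero, map_neg, Derivation.map_smul, vfield_of_mem_grade_zero hu, actA_X]
  · intro i j
    rw [lie_eq_zero_of_mem_grade (by norm_num) (hx i) (hx j), twist_of_mem_grade_one c (hx i),
      twist_of_mem_grade_one c (hx j)]
    simp
  · intro i j
    rw [twist_of_mem_grade_zero c (lie_mem_grade (by norm_num) (hx i) (he j)), hPart_lie_xi_eta,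
      twist_of_mem_grade_one c (hx i), twist_of_mem_grade_neg_one c (he j), etaX_eta, map_zero,
      sub_zero, map_neg, Derivation.map_smul, vfield_xi, pderiv_X_eq]
    split_ifs <;> simp [smul_eq_C_mul]
  · intro i j
    rw [lie_eq_zero_of_mem_grade (by norm_num) (he i) (he j), twist_of_mem_grade_neg_one c (he i),
      twist_of_mem_grade_neg_one c (he j), etaX_eta, etaX_eta, map_neg, map_neg,
      Derivation.map_smul, Derivation.map_smul, vfield_eta, vfield_eta, P_X_comm i j]
    simp

/-- The operator on polynomials by which `g` acts. -/
def op (c : ℂ) (g : G) : Module.End ℂ A :=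
  (vfield g : A →ₗ[ℂ] A) + LinearMap.mulLeft ℂ (twist c g)

theorem op_apply (c : ℂ) (g : G) (f : A) : op c g f = vfield g f + twist c g * f := rfl

theorem op_lie (c : ℂ) (g h : G) (f : A) :
    op c ⁅g, h⁆ f = op c g (op c h f) - op c h (op c g f) := by
  simp only [op_apply, vfield_lie, twist_lie, Derivation.commutator_apply, map_add,
    Derivation.leibniz, smul_eq_mul]
  ring

theorem op_add (c : ℂ) (g h : G) : op c (g + h) = op c g + op c h := by
  refine LinearMap.ext fun f => ?_
  simp only [op_apply, map_add, Derivation.add_apply, LinearMap.add_apply]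
  ring

theorem op_smul (c r : ℂ) (g : G) : op c (r • g) = r • op c g := by
  refine LinearMap.ext fun f => ?_
  simp only [op_apply, map_smul, Derivation.smul_apply, LinearMap.smul_apply, smul_add,
    smul_mul_assoc]

/-! ### Irreducibility -/

theorem op_xi (c : ℂ) (i : Fin 16) (f : A) : op c (xi i) f = pderiv i f := by
  rw [op_apply, vfield_xi, twist_of_mem_grade_one c (xi_mem_grade i), zero_mul, add_zero]

theorem op_eta (c : ℂ) (i : Fin 16) (f : A) : op c (eta i) f = P i f - (c / 2) • (X i * f) := by
  rw [op_apply, vfield_eta, twist_of_mem_grade_neg_one c (eta_mem_grade i), etaX_eta, neg_mul,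
    smul_mul_assoc, sub_eq_add_neg]

theorem deg_of_isHomogeneous {n : ℕ} {f : A} (hf : f.IsHomogeneous n) : deg f = (n : ℂ) • f := by
  rw [deg_apply, hf.sum_X_mul_pderiv, Nat.cast_smul_eq_nsmul]

theorem isHomogeneous_pderiv_zeta (v : Fin 10) (i : Fin 16) :
    (pderiv i (zeta (v + 1))).IsHomogeneous 1 := by
  rw [pderiv_zeta, intCast_eq_C]
  exact isHomogeneous_C_mul_X _ _

theorem sum_X_mul_pderiv_zeta (v : Fin 10) :
    ∑ i, X i * pderiv i (zeta (v + 1)) = 2 * zeta (v + 1) := by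
  rw [two_mul_zeta]
  exact Finset.sum_congr rfl fun i _ => by rw [pderiv_zeta]; ring

/-- The vector fields contribute `m - 6` by `sum_P_pderiv_zeta_mul`. The twist contributes `-(c/2) ·
2 = -c`, by Euler's identity for the quadric `ζ_v`. -/
theorem sum_op_eta_pderiv_zeta_mul (c : ℂ) (v : Fin 10) {m : ℕ} {g : A} (hg : g.IsHomogeneous m) :
    ∑ i, op c (eta i) (pderiv i (zeta (v + 1)) * g) =
      ((m : ℂ) - 6 - c) • (zeta (v + 1) * g) := by
  have h6 : (6 : A) = C 6 := (map_ofNat C 6).symm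
  have h2 : (2 : A) = C 2 := (map_ofNat C 2).symm
  simp only [op_eta, Finset.sum_sub_distrib, sum_P_pderiv_zeta_mul, ← Finset.smul_sum,
    ← mul_assoc, ← Finset.sum_mul, sum_X_mul_pderiv_zeta, deg_of_isHomogeneous hg]
  have hc : (C c : A) = C (c / 2) * C 2 := by rw [← map_mul]; congr 1; ring
  rw [h6, h2]
  simp only [smul_eq_C_mul, map_sub]
  rw [hc]
  ring

/-- Euler's identity gives the scalar: the sum of the `x_i ∂_i f` is `(n + 1) f`, and each term
carries the factor `n` from `deg` on `∂_i f` and `-c/2` from the twist. The rest lies in the ideal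
of the quadrics. -/
theorem sum_op_eta_pderiv (c : ℂ) {n : ℕ} {f : A} (hf : f.IsHomogeneous (n + 1)) :
    ∑ i, op c (eta i) (pderiv i f) = (((n : ℂ) + 1) * ((n : ℂ) - c / 2)) • f
      - ∑ v : Fin 10, ∑ i, (pairSgn v i : ℂ) •
        (zeta (v + 1) * pderiv (partner v i) (pderiv i f)) := by
  have h1 : ∀ i, deg (pderiv i f) = (n : ℂ) • pderiv i f := fun i => by
    have h := hf.pderiv (i := i)
    rw [Nat.add_sub_cancel] at h
    exact deg_of_isHomogeneous h
  have h2 := deg_of_isHomogeneous hf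
  rw [deg_apply] at h2
  simp only [op_eta, Finset.sum_sub_distrib, sum_P_pderiv, h1, mul_smul_comm, ← Finset.smul_sum,
    h2]
  have h3 : ∀ v : Fin 10, zeta (v + 1) *
      ∑ i, (pairSgn v i : A) * pderiv (partner v i) (pderiv i f) =
      ∑ i, (pairSgn v i : ℂ) • (zeta (v + 1) * pderiv (partner v i) (pderiv i f)) := by
    intro v
    rw [Finset.mul_sum]
    refine Finset.sum_congr rfl fun i _ => ?_
    rw [smul_eq_C_mul, ← intCast_eq_C]
    ring
  rw [Finset.sum_congr rfl fun v _ => h3 v, sub_right_comm, smul_smul, smul_smul, ← sub_smul]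
  congr 2
  push_cast
  ring

/-! ### Invariant subspaces of the polynomial algebra -/

section Submodule

variable {c : ℂ} {U : Submodule ℂ A}

/-- Differentiation by the `ξ_i` lowers the degree until a nonzero constant is reached; a nonzero
polynomial killed by all partial derivatives is one. -/
theorem one_mem_of_lt (hU : ∀ g : G, ∀ f ∈ U, op c g f ∈ U) (n : ℕ) :
    ∀ f ∈ U, f ≠ 0 → (∀ m ∈ f.support, m.degree < n) → (1 : A) ∈ U := by
  induction n with
  | zero =>
    intro f _ h0 h
    obtain ⟨m, hm⟩ := Finset.nonempty_iff_ne_empty.2 (mt support_eq_empty.1 h0)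
    exact absurd (h m hm) (Nat.not_lt_zero _)
  | succ n ih =>
    intro f hf h0 h
    by_cases hp : ∀ i, pderiv i f = 0
    · have h1 := eq_C_of_pderiv_eq_zero f hp
      have h2 : constantCoeff f ≠ 0 := fun h => h0 (by rw [h1, h, C_0])
      have h3 : (1 : A) = (constantCoeff f)⁻¹ • f := by
        conv_rhs => rw [h1]
        rw [smul_eq_C_mul, constantCoeff_C, ← map_mul, inv_mul_cancel₀ h2, map_one]
      rw [h3]
      exact U.smul_mem _ hf
    · push Not at hp
      obtain ⟨i, hi⟩ := hp
      refine ih (pderiv i f) (op_xi c i f ▸ hU (xi i) f hf) hi fun m hm => ?_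
      rw [mem_support_iff, coeff_pderiv] at hm
      have h1 := h _ (mem_support_iff.2 (left_ne_zero_of_mul hm))
      rw [map_add, Finsupp.degree_single] at h1
      omega

theorem one_mem (hU : ∀ g : G, ∀ f ∈ U, op c g f ∈ U) (h : U ≠ ⊥) : (1 : A) ∈ U := by
  obtain ⟨f, hf, h0⟩ := (Submodule.ne_bot_iff U).1 h
  exact one_mem_of_lt hU (f.support.sup Finsupp.degree + 1) f hf h0 fun m hm =>
    Nat.lt_succ_of_le (Finset.le_sup (f := Finsupp.degree) hm)

theorem mem_of_isHomogeneous (hU : ∀ g : G, ∀ f ∈ U, op c g f ∈ U)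
    (hc : ∀ n : ℕ, c ≠ (n : ℂ) - 6) (h1 : (1 : A) ∈ U) (n : ℕ) :
    ∀ f : A, f.IsHomogeneous n → f ∈ U := by
  induction n with
  | zero =>
    intro f hf
    rw [totalDegree_eq_zero_iff_eq_C.1 (Nat.le_zero.1 hf.totalDegree_le), ← mul_one (C _),
      ← smul_eq_C_mul]
    exact U.smul_mem _ h1
  | succ n ih =>
    intro f hf
    have hd : ∀ i, (pderiv i f).IsHomogeneous n := fun i => by
      have h := hf.pderiv (i := i)
      rwa [Nat.add_sub_cancel] at h
    have hz : ∀ (v : Fin 10) (i j : Fin 16), zeta (v + 1) * pderiv j (pderiv i f) ∈ U := by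
      intro v i j
      -- For `f` of degree 1 the second derivatives vanish. Otherwise they have degree `m = n - 1`,
      -- and multiplying by the linear forms `∂_kζ_v` gives degree `n`, where the induction
      -- hypothesis applies.
      rcases n with _ | m
      · rw [totalDegree_eq_zero_iff_eq_C.1 (Nat.le_zero.1 (hd i).totalDegree_le), pderiv_C,
          mul_zero]
        exact U.zero_mem
      · have hg : (pderiv j (pderiv i f)).IsHomogeneous m := by
          have h := (hd i).pderiv (i := j)
          rwa [Nat.add_sub_cancel] at h
        have hs := sum_op_eta_pderiv_zeta_mul c v hg
        have hmem := U.sum_mem fun k (_ : k ∈ Finset.univ) => hU (eta k) _ (ih _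
          (add_comm 1 m ▸ (isHomogeneous_pderiv_zeta v k).mul hg))
        rw [hs] at hmem
        refine (U.smul_mem_iff fun h0 => hc m ?_).1 hmem
        linear_combination -h0
    have hs := sum_op_eta_pderiv c hf
    have hmem := U.sum_mem fun k (_ : k ∈ Finset.univ) => hU (eta k) _ (ih _ (hd k))
    rw [hs] at hmem
    have hsub := (U.sub_mem_iff_left (U.sum_mem fun v _ => U.sum_mem fun i _ =>
      U.smul_mem _ (hz v i (partner v i)))).1 hmem
    refine (U.smul_mem_iff (mul_ne_zero (Nat.cast_add_one_ne_zero n) fun h0 => ?_)).1 hsub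
    -- The second scalar vanishes only for `c = 2n`, which is the excluded value with index `2n +
    -- 6`.
    refine hc (2 * n + 6) ?_
    push_cast
    linear_combination -2 * h0

theorem eq_top_of_ne_bot (hU : ∀ g : G, ∀ f ∈ U, op c g f ∈ U)
    (hc : ∀ n : ℕ, c ≠ (n : ℂ) - 6) (h : U ≠ ⊥) : U = ⊤ := by
  refine (Submodule.eq_top_iff').2 fun f => ?_
  rw [← sum_homogeneousComponent f]
  exact U.sum_mem fun n _ => mem_of_isHomogeneous hU hc (one_mem hU h) n _
    (homogeneousComponent_isHomogeneous n f)

end Submodule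

/-! ### The module attached to the trivial representation -/

section Trivial

variable {M : Type*} [AddCommGroup M] [Module ℂ M] [LieRingModule D5 M] [LieModule ℂ D5 M]
  [LieModule.IsTrivial D5 M]

theorem rho_apply (c : ℂ) (u : G) (m : M) : rho c u m = (c / 2 * hPart u 5) • m := by
  rw [rho, LinearMap.add_apply, LieModule.toEnd_apply_apply, LieModule.IsTrivial.trivial, zero_add,
    LinearMap.smul_apply, LinearMap.id_apply, hatCoeff]
  congr 1
  ring

/-- On trivial `M`, `rho c u` is the scalar `(c/2) · hPart u 5`, and for `[ξ_r, η_i]` it is nonzero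
only if `r = i`. So all twisting terms assemble into multiplication by `twist c g`. -/
theorem iota_tmul (c : ℂ) (g : G) (f : A) (m : M) : iota c g (f ⊗ₜ[ℂ] m) = op c g f ⊗ₜ[ℂ] m := by
  have h1 : ∀ i : Fin 16, ∑ r : Fin 16, TensorProduct.map (LinearMap.mulLeft ℂ (X r : A))
      (rho c ⁅xi r, eta i⁆) (f ⊗ₜ[ℂ] m) = -((c / 2) • ((X i * f) ⊗ₜ[ℂ] m)) := by
    intro i
    simp only [TensorProduct.map_tmul, rho_apply, hPart_lie_xi_eta, LinearMap.mulLeft_apply]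
    rw [Finset.sum_eq_single i]
    · simp [TensorProduct.tmul_smul, TensorProduct.tmul_neg]
    · intro r _ hr
      simp [hr]
    · simp
  simp only [iota, LinearMap.add_apply, LinearMap.sum_apply, LinearMap.smul_apply,
    LinearMap.rTensor_tmul, LinearMap.lTensor_tmul, rho_apply, hPart_zeroPart, h1, op_apply,
    vfield_apply, twist_apply, etaX_apply, Derivation.add_apply, derivation_sum_apply,
    Derivation.smul_apply, Derivation.coeFn_coe, TensorProduct.tmul_smul]
  simp only [TensorProduct.add_tmul, TensorProduct.sum_tmul, sub_mul, TensorProduct.sub_tmul,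
    ← smul_eq_C_mul, Finset.smul_sum, Finset.sum_mul, smul_mul_assoc, TensorProduct.smul_tmul',
    smul_add, Finset.sum_add_distrib, smul_neg, Finset.sum_neg_distrib]
  simp only [smul_comm (c / 2)]
  abel

theorem iota_add (c : ℂ) (g h : G) (w : A ⊗[ℂ] M) : iota c (g + h) w = iota c g w + iota c h w := by
  induction w with
  | zero => simp
  | tmul f m => rw [iota_tmul, iota_tmul, iota_tmul, op_add, LinearMap.add_apply,
      TensorProduct.add_tmul]
  | add x y hx hy => rw [map_add, map_add, map_add, hx, hy]; abel

theorem iota_smul (c r : ℂ) (g : G) (w : A ⊗[ℂ] M) : iota c (r • g) w = r • iota c g w := by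
  induction w with
  | zero => simp
  | tmul f m => rw [iota_tmul, iota_tmul, op_smul, LinearMap.smul_apply, TensorProduct.smul_tmul']
  | add x y hx hy => rw [map_add, map_add, hx, hy, smul_add]

theorem iota_lie (c : ℂ) (g h : G) (w : A ⊗[ℂ] M) :
    iota c ⁅g, h⁆ w = iota c g (iota c h w) - iota c h (iota c g w) := by
  induction w with
  | zero => simp
  | tmul f m => simp only [iota_tmul, op_lie, TensorProduct.sub_tmul]
  | add x y hx hy => simp only [map_add, hx, hy]; abel

/-- The action of `G` on `ℂ[x₁, …, x₁₆] ⊗ M`. -/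
abbrev lieRingModule (c : ℂ) : LieRingModule G (A ⊗[ℂ] M) where
  bracket g w := iota c g w
  add_lie := iota_add c
  lie_add g := map_add (iota c g)
  leibniz_lie g h w := by
    change iota c g (iota c h w) = iota c ⁅g, h⁆ w + iota c h (iota c g w)
    rw [iota_lie, sub_add_cancel]

theorem eq_top_of_iota_mem (hM : Module.finrank ℂ M = 1) {c : ℂ}
    (hc : ∀ n : ℕ, c ≠ (n : ℂ) - 6) (N : Submodule ℂ (A ⊗[ℂ] M))
    (hN : ∀ g : G, ∀ w ∈ N, iota c g w ∈ N) (h : N ≠ ⊥) : N = ⊤ := by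
  have : Module.Finite ℂ M := Module.finite_of_finrank_eq_succ hM
  let e : M ≃ₗ[ℂ] ℂ := LinearEquiv.ofFinrankEq M ℂ (by rw [hM, Module.finrank_self])
  -- A choice of basis vector of `M` identifies `iota c` with `op c`, so the statement on invariant
  -- subspaces of `A` can be transported back.
  let Φ : A ⊗[ℂ] M ≃ₗ[ℂ] A := (LinearEquiv.lTensor A e).trans (TensorProduct.rid ℂ A)
  have hΦ : ∀ g w, Φ (iota c g w) = op c g (Φ w) := by
    intro g w
    induction w with
    | zero => simp
    | tmul f m => simp [Φ, iota_tmul]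
    | add x y hx hy => simp only [map_add, hx, hy]
  have hU : N.map (Φ : A ⊗[ℂ] M →ₗ[ℂ] A) = ⊤ := by
    refine eq_top_of_ne_bot (c := c) ?_ hc ?_
    · rintro g _ ⟨w, hw, rfl⟩
      exact ⟨iota c g w, hN g w hw, hΦ g w⟩
    · intro h0
      refine h ((Submodule.eq_bot_iff N).2 fun w hw => ?_)
      have h1 := (Submodule.eq_bot_iff _).1 h0 _ (Submodule.mem_map_of_mem hw)
      exact Φ.map_eq_zero_iff.1 h1
  refine (Submodule.eq_top_iff').2 fun w => ?_
  obtain ⟨w', hw', h1⟩ : Φ w ∈ N.map (Φ : A ⊗[ℂ] M →ₗ[ℂ] A) := hU ▸ Submodule.mem_top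
  exact Φ.injective h1 ▸ hw'

end Trivial

end E6
end

theorem corollary6p5 {M : Type*} [AddCommGroup M] [Module ℂ M] [LieRingModule E6.D5 M]
    [LieModule ℂ E6.D5 M] [LieModule.IsTrivial E6.D5 M] (hM : Module.finrank ℂ M = 1)
    (c : ℂ) (hc : ∀ n : ℕ, c ≠ (n : ℂ) - 6) :
    ∃ (_ : LieRingModule E6.G (E6.A ⊗[ℂ] M)) (_ : LieModule ℂ E6.G (E6.A ⊗[ℂ] M)),
      (∀ (g : E6.G) (w : E6.A ⊗[ℂ] M), ⁅g, w⁆ = E6.iota c g w) ∧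
        LieModule.IsIrreducible ℂ E6.G (E6.A ⊗[ℂ] M) := by
  let := E6.lieRingModule (M := M) c
  let : LieModule ℂ E6.G (E6.A ⊗[ℂ] M) :=
    { smul_lie := fun r g w => E6.iota_smul c r g w
      lie_smul := fun r g w => map_smul (E6.iota c g) r w }
  refine ⟨inferInstance, inferInstance, fun g w => rfl, ?_⟩
  have : Nontrivial M := Module.nontrivial_of_finrank_eq_succ hM
  have : Nontrivial (E6.A ⊗[ℂ] M) := Module.FaithfullyFlat.lTensor_nontrivial ℂ E6.A M
  refine LieModule.IsIrreducible.mk fun N hN => ?_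
  rw [← LieSubmodule.toSubmodule_eq_top]
  refine E6.eq_top_of_iota_mem hM hc N.toSubmodule (fun g w hw => N.lie_mem hw) ?_
  rwa [Ne, LieSubmodule.toSubmodule_eq_bot]
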